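/- Let $k$ be a commutative unital ring and let $As^2$ be the nonsymmetric operad of linearly compatible di-algebras: it is generated by two binary operations $*$ and $\bullet$ of degree $0$, both associative, with the relation $(x\bullet y)*z+(x*y)\bullet z=x\bullet(y*z)+x*(y\bullet z)$. Write $E$ for the free module on $*,\bullet$, $R$ for the module of these relations, and let $C=(As^2)^{¡}=\mathcal C(sE,s^2R)$ be the Koszul dual cooperad, i.e. the largest sub-cooperad of the cofree conilpotent cooperad $\mathcal T^c(sE)$ whose weight two part lies in $s^2R$. Let $As^2_\infty=\Omega(C)=(\mathcal T(s^{-1}\overline C),\partial)$ be its cobar construction, where $\overline C$ is the part of $C$ of arity at least two, and $\partial$ is the derivation of degree $-1$ induced by the infinitesimal decomposition of $C$ (which is well defined, as the unique restriction to $C$ of that of $\mathcal T^c(sE)$). Then $\partial^2=0$, and there are elements $\mu^c_{ij}\in C(i+j+1)$ for $i,j\ge 0$ such that, in the basis of $\mathcal T^c(sE)$ given by planar binary trees with vertices labelled by $*$ and $\bullet$, the coefficient of $\mu^c_{ij}$ is $\pm1$ at each tree with exactly $i$ labels $*$ and $j$ labels $\bullet$, and $0$ at every other tree, and such that the operations $m_{ij}:=s^{-1}\mu^c_{ij}$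 with $i+j\ge1$ have the following properties. (1) For $i+j=n-1$, $n\ge 2$, $m_{ij}$ has arity $n$ and degree $n-2$, and the graded nonsymmetric operad underlying $As^2_\infty$ is free on the operations $m_{ij}$ ($i,j\ge0$, $i+j\ge1$). (2) For all $i,j\ge0$ with $i+j\ge1$, $$\partial(m_{ij})=\sum(-1)^{p+qr}\,m_{ab}(\underbrace{\mathrm{id},\dots,\mathrm{id}}_{p},m_{cd},\underbrace{\mathrm{id},\dots,\mathrm{id}}_{r}),$$ where the sum is over all integers $a,b,c,d,p,q,r\ge0$ with $a+c=i$, $b+d=j$, $q=c+d+1$, $p+q+r=i+j+1$, $a+b\ge1$ and $c+d\ge1$. -/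

import Mathlib

open scoped TensorProduct

universe u v w

/-! ## Graded nonsymmetric operads

An operad is given by its partial compositions `x ∘ᵢ y`, with inputs numbered from `0`.  The arity
and the degree of a composite are variables tied to those of the factors by equations, so that the
axioms need no transport. -/

/-- The sign `(-1)^d` as an element of `k`. -/
def koszulSign (k : Type u) [CommRing k] (d : ℤ) : k := ((d.negOnePow : ℤˣ) : ℤ)

theorem koszulSign_add (k : Type u) [CommRing k] (a b : ℤ) :
    koszulSign k (a + b) = koszulSign k a * koszulSign k b := by
  simp [koszulSign, Int.negOnePow_add]

theorem koszulSign_zero (k : Type u) [CommRing k] : koszulSign k 0 = 1 := by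
  simp [koszulSign]

/-- A graded nonsymmetric operad over `k`; `Op n d` is the module of operations of arity `n` and
degree `d`. -/
structure GradedNSOperad (k : Type u) [CommRing k] where
  Op : ℕ → ℤ → Type v
  [addCommGroup : ∀ n d, AddCommGroup (Op n d)]
  [module : ∀ n d, Module k (Op n d)]
  /-- the identity operation -/
  one : Op 1 0
  /-- the partial composition `x ∘ᵢ y` -/
  comp : ∀ {m n r : ℕ} {d e f : ℤ} (i : ℕ), i < m → m + n = r + 1 → d + e = f →
    (Op m d →ₗ[k] Op n e →ₗ[k] Op r f)
  one_comp : ∀ {n : ℕ} {d : ℤ} (hi : 0 < 1) (hr : 1 + n = n + 1) (hd : 0 + d = d) (x : Op n d),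
    comp 0 hi hr hd one x = x
  comp_one : ∀ {n : ℕ} {d : ℤ} (i : ℕ) (hi : i < n) (hr : n + 1 = n + 1) (hd : d + 0 = d)
    (x : Op n d), comp i hi hr hd x one = x
  /-- sequential composition: `(x ∘ᵢ y) ∘ᵢ₊ⱼ z = x ∘ᵢ (y ∘ⱼ z)` -/
  comp_seq : ∀ {l m n a b r : ℕ} {d e f g h t : ℤ} (i j : ℕ) (hi : i < l) (hj : j < m)
    (hij : i + j < a) (h₁ : l + m = a + 1) (g₁ : d + e = g) (h₂ : a + n = r + 1) (g₂ : g + f = t)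
    (h₃ : m + n = b + 1) (g₃ : e + f = h) (h₄ : l + b = r + 1) (g₄ : d + h = t)
    (x : Op l d) (y : Op m e) (z : Op n f),
    comp (i + j) hij h₂ g₂ (comp i hi h₁ g₁ x y) z = comp i hi h₄ g₄ x (comp j hj h₃ g₃ y z)
  /-- parallel composition: `(x ∘ᵢ y) ∘ⱼ₊ₘ₋₁ z = (-1)^(|y||z|) (x ∘ⱼ z) ∘ᵢ y` for `i < j`, where
  `m` is the arity of `y` -/
  comp_par : ∀ {l m n a b r : ℕ} {d e f g h t : ℤ} (i j j' : ℕ) (hi : i < l) (hj : j < l)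
    (_ : i < j) (_ : j' + 1 = j + m) (hj' : j' < a) (hib : i < b)
    (h₁ : l + m = a + 1) (g₁ : d + e = g) (h₂ : a + n = r + 1) (g₂ : g + f = t)
    (h₃ : l + n = b + 1) (g₃ : d + f = h) (h₄ : b + m = r + 1) (g₄ : h + e = t)
    (x : Op l d) (y : Op m e) (z : Op n f),
    comp j' hj' h₂ g₂ (comp i hi h₁ g₁ x y) z =
      koszulSign k (e * f) • comp i hib h₄ g₄ (comp j hj h₃ g₃ x z) y

namespace GradedNSOperad

attribute [instance] GradedNSOperad.addCommGroup GradedNSOperad.module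

variable {k : Type u} [CommRing k]

/-- A morphism of graded nonsymmetric operads (of degree `0`). -/
@[ext]
structure Hom (P : GradedNSOperad.{u, v} k) (Q : GradedNSOperad.{u, w} k) where
  toFun : ∀ (n : ℕ) (d : ℤ), P.Op n d →ₗ[k] Q.Op n d
  map_one : toFun 1 0 P.one = Q.one
  map_comp : ∀ {m n r : ℕ} {d e f : ℤ} (i : ℕ) (hi : i < m) (hr : m + n = r + 1) (hd : d + e = f)
    (x : P.Op m d) (y : P.Op n e),
    toFun r f (P.comp i hi hr hd x y) = Q.comp i hi hr hd (toFun m d x) (toFun n e y)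

/-- A derivation of degree `-1`. -/
structure Deriv (P : GradedNSOperad.{u, v} k) where
  toFun : ∀ (n : ℕ) (d : ℤ), P.Op n d →ₗ[k] P.Op n (d - 1)
  leibniz : ∀ {m n r : ℕ} {d e f : ℤ} (i : ℕ) (hi : i < m) (hr : m + n = r + 1) (hd : d + e = f)
    (h₁ : d - 1 + e = f - 1) (h₂ : d + (e - 1) = f - 1) (x : P.Op m d) (y : P.Op n e),
    toFun r f (P.comp i hi hr hd x y) =
      P.comp i hi hr h₁ (toFun m d x) y + koszulSign k d • P.comp i hi hr h₂ x (toFun n e y)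

/-- A derivation of degree `-1` is a differential when its square is zero; an operad together with
such a derivation is a dg operad. -/
def Deriv.IsDifferential {P : GradedNSOperad.{u, v} k} (D : P.Deriv) : Prop :=
  ∀ (n : ℕ) (d : ℤ) (x : P.Op n d), D.toFun n (d - 1) (D.toFun n d x) = 0

/-- The operad `P ⊕ ε P` with `ε` of degree `1` and `ε² = 0`.  A morphism `x ↦ x + ε D x` into it is
the same as a derivation `D`. -/
def dual (P : GradedNSOperad.{u, v} k) : GradedNSOperad.{u, v} k where
  Op n d := P.Op n d × P.Op n (d - 1)
  one := (P.one, 0)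
  comp {m n r d e f} i hi hr hd := LinearMap.mk₂ k
    (fun x y => (P.comp i hi hr hd x.1 y.1,
      P.comp i hi hr (by omega) x.2 y.1 + koszulSign k d • P.comp i hi hr (by omega) x.1 y.2))
    (by intro x x' y; ext <;> simp; abel)
    (by intro c x y; ext <;> simp [smul_comm c])
    (by intro x y y'; ext <;> simp; abel)
    (by intro c x y; ext <;> simp [smul_comm c])
  one_comp hi hr hd x := by
    ext
    · exact P.one_comp hi hr hd x.1
    · simpa [koszulSign_zero] using P.one_comp hi hr _ x.2
  comp_one i hi hr hd x := by
    ext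
    · exact P.comp_one i hi hr hd x.1
    · simpa using P.comp_one i hi hr _ x.2
  comp_seq {l m n a b r d e f g h t} i j hi hj hij h₁ g₁ h₂ g₂ h₃ g₃ h₄ g₄ x y z := by
    subst g₁
    ext
    · exact P.comp_seq i j hi hj hij h₁ rfl h₂ g₂ h₃ g₃ h₄ g₄ x.1 y.1 z.1
    · simp only [LinearMap.mk₂_apply, map_add, map_smul, LinearMap.add_apply, LinearMap.smul_apply]
      rw [P.comp_seq i j hi hj hij h₁ _ h₂ _ h₃ g₃ h₄ (by omega) x.2 y.1 z.1,
        P.comp_seq i j hi hj hij h₁ _ h₂ _ h₃ (show e - 1 + f = h - 1 by omega) h₄ (by omega)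
          x.1 y.2 z.1,
        P.comp_seq i j hi hj hij h₁ _ h₂ _ h₃ (show e + (f - 1) = h - 1 by omega) h₄ (by omega)
          x.1 y.1 z.2,
        koszulSign_add, smul_add, smul_smul, add_assoc]
  comp_par {l m n a b r d e f g h t} i j j' hi hj hij hjm hj' hib h₁ g₁ h₂ g₂ h₃ g₃ h₄ g₄ x y z := by
    subst g₁ g₃
    have s1 : koszulSign k d * koszulSign k ((e - 1) * f) =
        koszulSign k (e * f) * koszulSign k (d + f) := by
      have : d + (e - 1) * f + 2 * f = e * f + (d + f) := by ring
      rw [← koszulSign_add, ← koszulSign_add, ← this, koszulSign_add k _ (2 * f)]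
      simp [koszulSign]
    have s2 : koszulSign k (d + e) * koszulSign k (e * (f - 1)) =
        koszulSign k (e * f) * koszulSign k d := by
      rw [← koszulSign_add, ← koszulSign_add]
      congr 1
      ring
    ext
    · exact P.comp_par i j j' hi hj hij hjm hj' hib h₁ rfl h₂ g₂ h₃ rfl h₄ g₄ x.1 y.1 z.1
    · simp only [LinearMap.mk₂_apply, map_add, map_smul, LinearMap.add_apply, LinearMap.smul_apply,
        Prod.smul_snd]
      rw [P.comp_par i j j' hi hj hij hjm hj' hib h₁ _ h₂ _ h₃
          (show d - 1 + f = d + f - 1 by omega) h₄ (by omega) x.2 y.1 z.1,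
        P.comp_par i j j' hi hj hij hjm hj' hib h₁ _ h₂ _ h₃ rfl h₄ (by omega) x.1 y.2 z.1,
        P.comp_par i j j' hi hj hij hjm hj' hib h₁ _ h₂ _ h₃
          (show d + (f - 1) = d + f - 1 by omega) h₄ (by omega) x.1 y.1 z.2]
      simp only [smul_add, smul_smul, s1, s2]
      exact add_right_comm _ _ _

/-- The component `x` of `x + ε y`. -/
def dualFst (P : GradedNSOperad.{u, v} k) (n : ℕ) (d : ℤ) : P.dual.Op n d →ₗ[k] P.Op n d :=
  LinearMap.fst k (P.Op n d) (P.Op n (d - 1))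

/-- The component `y` of `x + ε y`. -/
def dualSnd (P : GradedNSOperad.{u, v} k) (n : ℕ) (d : ℤ) : P.dual.Op n d →ₗ[k] P.Op n (d - 1) :=
  LinearMap.snd k (P.Op n d) (P.Op n (d - 1))

/-- The projection `x + ε y ↦ x` as a morphism. -/
def dualFstHom (P : GradedNSOperad.{u, v} k) : P.dual.Hom P where
  toFun := P.dualFst
  map_one := rfl
  map_comp _ _ _ _ _ _ := rfl

theorem dualSnd_comp (P : GradedNSOperad.{u, v} k) {m n r : ℕ} {d e f : ℤ} (i : ℕ) (hi : i < m)
    (hr : m + n = r + 1) (hd : d + e = f) (h₁ : d - 1 + e = f - 1) (h₂ : d + (e - 1) = f - 1)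
    (x : P.dual.Op m d) (y : P.dual.Op n e) :
    P.dualSnd r f (P.dual.comp i hi hr hd x y) =
      P.comp i hi hr h₁ (P.dualSnd m d x) (P.dualFst n e y) +
        koszulSign k d • P.comp i hi hr h₂ (P.dualFst m d x) (P.dualSnd n e y) := rfl

/-- The composite of two morphisms. -/
def Hom.comp {P Q R : GradedNSOperad.{u, v} k} (G : Q.Hom R) (F : P.Hom Q) :
    P.Hom R where
  toFun n d := G.toFun n d ∘ₗ F.toFun n d
  map_one := by simp [F.map_one, G.map_one]
  map_comp i hi hr hd x y := by simp [F.map_comp, G.map_comp]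

/-- The identity morphism. -/
def Hom.id (P : GradedNSOperad.{u, v} k) : P.Hom P where
  toFun _ _ := LinearMap.id
  map_one := rfl
  map_comp _ _ _ _ _ _ := rfl

end GradedNSOperad

/-! ## The free graded nonsymmetric operad -/

section Free

variable (k : Type u) [CommRing k] {ι : Type} (ar : ι → ℕ) (dg : ι → ℤ) (M : ι → Type u)
  [∀ s, AddCommGroup (M s)] [∀ s, Module k (M s)]

/-- Formal operadic expressions in the elements of the modules `M s`, where the elements of `M s`
have arity `ar s` and degree `dg s`. -/
inductive PreFreeOp : ℕ → ℤ → Type u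
  | of {n : ℕ} {d : ℤ} (s : ι) (hn : ar s = n) (hd : dg s = d) (x : M s) : PreFreeOp n d
  | one : PreFreeOp 1 0
  | comp {m n r : ℕ} {d e f : ℤ} (i : ℕ) (hi : i < m) (hr : m + n = r + 1) (hd : d + e = f)
      (x : PreFreeOp m d) (y : PreFreeOp n e) : PreFreeOp r f
  | zero {n : ℕ} {d : ℤ} : PreFreeOp n d
  | add {n : ℕ} {d : ℤ} (x y : PreFreeOp n d) : PreFreeOp n d
  | smul {n : ℕ} {d : ℤ} (c : k) (x : PreFreeOp n d) : PreFreeOp n d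

/-- The relations: congruence, the module axioms, linearity of the generators, bilinearity of the
compositions, and the operad axioms. -/
inductive FreeOpRel : ∀ {n : ℕ} {d : ℤ}, PreFreeOp k ar dg M n d → PreFreeOp k ar dg M n d → Prop
  | refl {n d} (x : PreFreeOp k ar dg M n d) : FreeOpRel x x
  | symm {n d} {x y : PreFreeOp k ar dg M n d} : FreeOpRel x y → FreeOpRel y x
  | trans {n d} {x y z : PreFreeOp k ar dg M n d} : FreeOpRel x y → FreeOpRel y z → FreeOpRel x z
  | add_congr {n d} {x x' y y' : PreFreeOp k ar dg M n d} :
      FreeOpRel x x' → FreeOpRel y y' → FreeOpRel (.add x y) (.add x' y')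
  | smul_congr {n d} (c : k) {x x' : PreFreeOp k ar dg M n d} :
      FreeOpRel x x' → FreeOpRel (.smul c x) (.smul c x')
  | comp_congr {m n r d e f} (i : ℕ) (hi : i < m) (hr : m + n = r + 1) (hd : d + e = f)
      {x x' : PreFreeOp k ar dg M m d} {y y' : PreFreeOp k ar dg M n e} :
      FreeOpRel x x' → FreeOpRel y y' →
      FreeOpRel (.comp i hi hr hd x y) (.comp i hi hr hd x' y')
  | add_assoc {n d} (x y z : PreFreeOp k ar dg M n d) :
      FreeOpRel (.add (.add x y) z) (.add x (.add y z))
  | add_comm {n d} (x y : PreFreeOp k ar dg M n d) : FreeOpRel (.add x y) (.add y x)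
  | zero_add {n d} (x : PreFreeOp k ar dg M n d) : FreeOpRel (.add .zero x) x
  | smul_add {n d} (c : k) (x y : PreFreeOp k ar dg M n d) :
      FreeOpRel (.smul c (.add x y)) (.add (.smul c x) (.smul c y))
  | add_smul {n d} (c c' : k) (x : PreFreeOp k ar dg M n d) :
      FreeOpRel (.smul (c + c') x) (.add (.smul c x) (.smul c' x))
  | mul_smul {n d} (c c' : k) (x : PreFreeOp k ar dg M n d) :
      FreeOpRel (.smul (c * c') x) (.smul c (.smul c' x))
  | one_smul {n d} (x : PreFreeOp k ar dg M n d) : FreeOpRel (.smul 1 x) x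
  | zero_smul {n d} (x : PreFreeOp k ar dg M n d) : FreeOpRel (.smul 0 x) .zero
  | of_add {n d} (s : ι) (hn : ar s = n) (hd : dg s = d) (x y : M s) :
      FreeOpRel (.of s hn hd (x + y)) (.add (.of s hn hd x) (.of s hn hd y))
  | of_smul {n d} (s : ι) (hn : ar s = n) (hd : dg s = d) (c : k) (x : M s) :
      FreeOpRel (.of s hn hd (c • x)) (.smul c (.of s hn hd x))
  | comp_add_left {m n r d e f} (i : ℕ) (hi : i < m) (hr : m + n = r + 1) (hd : d + e = f)
      (x x' : PreFreeOp k ar dg M m d) (y : PreFreeOp k ar dg M n e) :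
      FreeOpRel (.comp i hi hr hd (.add x x') y)
        (.add (.comp i hi hr hd x y) (.comp i hi hr hd x' y))
  | comp_smul_left {m n r d e f} (i : ℕ) (hi : i < m) (hr : m + n = r + 1) (hd : d + e = f) (c : k)
      (x : PreFreeOp k ar dg M m d) (y : PreFreeOp k ar dg M n e) :
      FreeOpRel (.comp i hi hr hd (.smul c x) y) (.smul c (.comp i hi hr hd x y))
  | comp_add_right {m n r d e f} (i : ℕ) (hi : i < m) (hr : m + n = r + 1) (hd : d + e = f)
      (x : PreFreeOp k ar dg M m d) (y y' : PreFreeOp k ar dg M n e) :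
      FreeOpRel (.comp i hi hr hd x (.add y y'))
        (.add (.comp i hi hr hd x y) (.comp i hi hr hd x y'))
  | comp_smul_right {m n r d e f} (i : ℕ) (hi : i < m) (hr : m + n = r + 1) (hd : d + e = f)
      (c : k) (x : PreFreeOp k ar dg M m d) (y : PreFreeOp k ar dg M n e) :
      FreeOpRel (.comp i hi hr hd x (.smul c y)) (.smul c (.comp i hi hr hd x y))
  | one_comp {n d} (hi : 0 < 1) (hr : 1 + n = n + 1) (hd : 0 + d = d)
      (x : PreFreeOp k ar dg M n d) : FreeOpRel (.comp 0 hi hr hd .one x) x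
  | comp_one {n d} (i : ℕ) (hi : i < n) (hr : n + 1 = n + 1) (hd : d + 0 = d)
      (x : PreFreeOp k ar dg M n d) : FreeOpRel (.comp i hi hr hd x .one) x
  | comp_seq {l m n a b r d e f g h t} (i j : ℕ) (hi : i < l) (hj : j < m)
      (hij : i + j < a) (h₁ : l + m = a + 1) (g₁ : d + e = g) (h₂ : a + n = r + 1) (g₂ : g + f = t)
      (h₃ : m + n = b + 1) (g₃ : e + f = h) (h₄ : l + b = r + 1) (g₄ : d + h = t)
      (x : PreFreeOp k ar dg M l d) (y : PreFreeOp k ar dg M m e) (z : PreFreeOp k ar dg M n f) :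
      FreeOpRel (.comp (i + j) hij h₂ g₂ (.comp i hi h₁ g₁ x y) z)
        (.comp i hi h₄ g₄ x (.comp j hj h₃ g₃ y z))
  | comp_par {l m n a b r d e f g h t} (i j j' : ℕ) (hi : i < l) (hj : j < l)
      (_ : i < j) (_ : j' + 1 = j + m) (hj' : j' < a) (hib : i < b)
      (h₁ : l + m = a + 1) (g₁ : d + e = g) (h₂ : a + n = r + 1) (g₂ : g + f = t)
      (h₃ : l + n = b + 1) (g₃ : d + f = h) (h₄ : b + m = r + 1) (g₄ : h + e = t)
      (x : PreFreeOp k ar dg M l d) (y : PreFreeOp k ar dg M m e) (z : PreFreeOp k ar dg M n f) :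
      FreeOpRel (.comp j' hj' h₂ g₂ (.comp i hi h₁ g₁ x y) z)
        (.smul (koszulSign k (e * f)) (.comp i hib h₄ g₄ (.comp j hj h₃ g₃ x z) y))

/-- The operations of arity `n` and degree `d` of the free operad. -/
def FreeOp (n : ℕ) (d : ℤ) : Type u :=
  Quot (FreeOpRel k ar dg M (n := n) (d := d))

instance (n : ℕ) (d : ℤ) : Zero (FreeOp k ar dg M n d) := ⟨Quot.mk _ .zero⟩

instance (n : ℕ) (d : ℤ) : Add (FreeOp k ar dg M n d) :=
  ⟨Quot.map₂ .add (fun _ _ _ h => .add_congr (.refl _) h) (fun _ _ _ h => .add_congr h (.refl _))⟩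

instance (n : ℕ) (d : ℤ) : SMul k (FreeOp k ar dg M n d) :=
  ⟨fun c => Quot.map (.smul c) (fun _ _ h => .smul_congr c h)⟩

theorem FreeOp.zero_add' {n : ℕ} {d : ℤ} (x : FreeOp k ar dg M n d) : 0 + x = x := by
  rcases x with ⟨x⟩; exact Quot.sound (.zero_add x)

theorem FreeOp.add_comm' {n : ℕ} {d : ℤ} (x y : FreeOp k ar dg M n d) : x + y = y + x := by
  rcases x with ⟨x⟩; rcases y with ⟨y⟩; exact Quot.sound (.add_comm x y)

theorem FreeOp.add_smul' {n : ℕ} {d : ℤ} (a b : k) (x : FreeOp k ar dg M n d) :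
    (a + b) • x = a • x + b • x := by
  rcases x with ⟨x⟩; exact Quot.sound (.add_smul a b x)

theorem FreeOp.one_smul' {n : ℕ} {d : ℤ} (x : FreeOp k ar dg M n d) : (1 : k) • x = x := by
  rcases x with ⟨x⟩; exact Quot.sound (.one_smul x)

theorem FreeOp.zero_smul' {n : ℕ} {d : ℤ} (x : FreeOp k ar dg M n d) : (0 : k) • x = 0 := by
  rcases x with ⟨x⟩; exact Quot.sound (.zero_smul x)

instance (n : ℕ) (d : ℤ) : AddCommGroup (FreeOp k ar dg M n d) where
  add_assoc := by rintro ⟨x⟩ ⟨y⟩ ⟨z⟩; exact Quot.sound (.add_assoc x y z)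
  zero_add := FreeOp.zero_add' k ar dg M
  add_zero x := by rw [FreeOp.add_comm', FreeOp.zero_add']
  add_comm := FreeOp.add_comm' k ar dg M
  neg x := (-1 : k) • x
  neg_add_cancel x := by
    show (-1 : k) • x + x = 0
    nth_rewrite 2 [← FreeOp.one_smul' k ar dg M x]
    rw [← FreeOp.add_smul', neg_add_cancel, FreeOp.zero_smul']
  nsmul := nsmulRec
  zsmul := @zsmulRec _ _ _ ⟨fun x => (-1 : k) • x⟩ nsmulRec

instance (n : ℕ) (d : ℤ) : Module k (FreeOp k ar dg M n d) :=
  Module.ofMinimalAxioms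
    (by rintro c ⟨x⟩ ⟨y⟩; exact Quot.sound (.smul_add c x y))
    (FreeOp.add_smul' k ar dg M)
    (by rintro c c' ⟨x⟩; exact Quot.sound (.mul_smul c c' x))
    (FreeOp.one_smul' k ar dg M)

/-- The free graded nonsymmetric operad `T(M)` on the modules `M s`, placed in arity `ar s` and
degree `dg s`. -/
def freeOperad : GradedNSOperad.{u, u} k where
  Op n d := FreeOp k ar dg M n d
  one := Quot.mk _ .one
  comp i hi hr hd := LinearMap.mk₂ k
    (Quot.map₂ (.comp i hi hr hd) (fun _ _ _ h => .comp_congr i hi hr hd (.refl _) h)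
      (fun _ _ _ h => .comp_congr i hi hr hd h (.refl _)))
    (by rintro ⟨x⟩ ⟨y⟩ ⟨z⟩; exact Quot.sound (.comp_add_left i hi hr hd x y z))
    (by rintro c ⟨x⟩ ⟨y⟩; exact Quot.sound (.comp_smul_left i hi hr hd c x y))
    (by rintro ⟨x⟩ ⟨y⟩ ⟨z⟩; exact Quot.sound (.comp_add_right i hi hr hd x y z))
    (by rintro c ⟨x⟩ ⟨y⟩; exact Quot.sound (.comp_smul_right i hi hr hd c x y))
  one_comp hi hr hd := by rintro ⟨x⟩; exact Quot.sound (.one_comp hi hr hd x)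
  comp_one i hi hr hd := by rintro ⟨x⟩; exact Quot.sound (.comp_one i hi hr hd x)
  comp_seq i j hi hj hij h₁ g₁ h₂ g₂ h₃ g₃ h₄ g₄ := by
    rintro ⟨x⟩ ⟨y⟩ ⟨z⟩
    exact Quot.sound (.comp_seq i j hi hj hij h₁ g₁ h₂ g₂ h₃ g₃ h₄ g₄ x y z)
  comp_par i j j' hi hj hij hjm hj' hib h₁ g₁ h₂ g₂ h₃ g₃ h₄ g₄ := by
    rintro ⟨x⟩ ⟨y⟩ ⟨z⟩
    exact Quot.sound (.comp_par i j j' hi hj hij hjm hj' hib h₁ g₁ h₂ g₂ h₃ g₃ h₄ g₄ x y z)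

namespace freeOperad

/-- The inclusion of the generators into the free operad. -/
def of {n : ℕ} {d : ℤ} (s : ι) (hn : ar s = n) (hd : dg s = d) :
    M s →ₗ[k] (freeOperad k ar dg M).Op n d where
  toFun x := Quot.mk _ (.of s hn hd x)
  map_add' x y := Quot.sound (.of_add s hn hd x y)
  map_smul' c x := Quot.sound (.of_smul s hn hd c x)

variable {k ar dg M} {Q : GradedNSOperad.{u, v} k}

/-- Evaluation of formal expressions in an operad `Q`. -/
def preLift (φ : ∀ {n : ℕ} {d : ℤ} (s : ι), ar s = n → dg s = d → (M s →ₗ[k] Q.Op n d)) :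
    ∀ {n : ℕ} {d : ℤ}, PreFreeOp k ar dg M n d → Q.Op n d
  | _, _, .of s hn hd x => φ s hn hd x
  | _, _, .one => Q.one
  | _, _, .comp i hi hr hd x y => Q.comp i hi hr hd (preLift φ x) (preLift φ y)
  | _, _, .zero => 0
  | _, _, .add x y => preLift φ x + preLift φ y
  | _, _, .smul c x => c • preLift φ x

theorem preLift_rel (φ : ∀ {n : ℕ} {d : ℤ} (s : ι), ar s = n → dg s = d → (M s →ₗ[k] Q.Op n d))
    {n : ℕ} {d : ℤ} {x y : PreFreeOp k ar dg M n d} (h : FreeOpRel k ar dg M x y) :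
    preLift φ x = preLift φ y := by
  induction h with
  | refl => rfl
  | symm _ ih => exact ih.symm
  | trans _ _ ih ih' => exact ih.trans ih'
  | add_congr _ _ ih ih' => simp only [preLift, ih, ih']
  | smul_congr _ _ ih => simp only [preLift, ih]
  | comp_congr _ _ _ _ _ _ ih ih' => simp only [preLift, ih, ih']
  | add_assoc => simp only [preLift, add_assoc]
  | add_comm => simp only [preLift, add_comm]
  | zero_add => simp only [preLift, zero_add]
  | smul_add => simp only [preLift, smul_add]
  | add_smul => simp only [preLift, add_smul]
  | mul_smul => simp only [preLift, mul_smul]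
  | one_smul => simp only [preLift, one_smul]
  | zero_smul => simp only [preLift, zero_smul]
  | of_add => simp only [preLift, map_add]
  | of_smul => simp only [preLift, map_smul]
  | comp_add_left => simp only [preLift, map_add, LinearMap.add_apply]
  | comp_smul_left => simp only [preLift, map_smul, LinearMap.smul_apply]
  | comp_add_right => simp only [preLift, map_add]
  | comp_smul_right => simp only [preLift, map_smul]
  | one_comp hi hr hd => exact Q.one_comp hi hr hd _
  | comp_one i hi hr hd => exact Q.comp_one i hi hr hd _
  | comp_seq i j hi hj hij h₁ g₁ h₂ g₂ h₃ g₃ h₄ g₄ =>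
    exact Q.comp_seq i j hi hj hij h₁ g₁ h₂ g₂ h₃ g₃ h₄ g₄ _ _ _
  | comp_par i j j' hi hj hij hjm hj' hib h₁ g₁ h₂ g₂ h₃ g₃ h₄ g₄ =>
    exact Q.comp_par i j j' hi hj hij hjm hj' hib h₁ g₁ h₂ g₂ h₃ g₃ h₄ g₄ _ _ _

/-- The morphism out of the free operad determined by its values on the generators. -/
def lift (φ : ∀ {n : ℕ} {d : ℤ} (s : ι), ar s = n → dg s = d → (M s →ₗ[k] Q.Op n d)) :
    (freeOperad k ar dg M).Hom Q where
  toFun n d :=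
    { toFun := Quot.lift (preLift φ) (fun _ _ h => preLift_rel φ h)
      map_add' := by rintro ⟨x⟩ ⟨y⟩; rfl
      map_smul' := by rintro c ⟨x⟩; rfl }
  map_one := rfl
  map_comp i hi hr hd := by rintro ⟨x⟩ ⟨y⟩; rfl

/-- The class of a formal expression. -/
def mk {n : ℕ} {d : ℤ} (x : PreFreeOp k ar dg M n d) : (freeOperad k ar dg M).Op n d :=
  Quot.mk _ x

/-- A morphism out of the free operad is determined by its values on the generators. -/
theorem hom_ext {F G : (freeOperad k ar dg M).Hom Q}
    (h : ∀ {n : ℕ} {d : ℤ} (s : ι) (hn : ar s = n) (hd : dg s = d) (x : M s),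
      F.toFun n d (of k ar dg M s hn hd x) = G.toFun n d (of k ar dg M s hn hd x)) : F = G := by
  have key : ∀ {n : ℕ} {d : ℤ} (x : PreFreeOp k ar dg M n d),
      F.toFun n d (mk x) = G.toFun n d (mk x) := by
    intro n d x
    induction x with
    | of s hn hd x => exact h s hn hd x
    | one => exact F.map_one.trans G.map_one.symm
    | comp i hi hr hd x y ihx ihy =>
      have e : mk (.comp i hi hr hd x y) =
        (freeOperad k ar dg M).comp i hi hr hd (mk x) (mk y) := rfl
      rw [e, F.map_comp, G.map_comp, ihx, ihy]
    | zero =>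
      exact (map_zero (F.toFun _ _)).trans (map_zero (G.toFun _ _)).symm
    | add x y ihx ihy =>
      have e : mk (.add x y) = mk x + mk y := rfl
      rw [e, map_add, map_add, ihx, ihy]
    | smul c x ih =>
      have e : mk (.smul c x) = c • mk x := rfl
      rw [e, map_smul, map_smul, ih]
  ext n d x
  rcases x with ⟨x⟩
  exact key x

/-- The morphism `x ↦ x + ε D x` extending `x ↦ x + ε ψ x` from the generators. -/
def derivHom (ψ : ∀ {n : ℕ} {d : ℤ} (s : ι), ar s = n → dg s = d →
    (M s →ₗ[k] (freeOperad k ar dg M).Op n (d - 1))) :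
    (freeOperad k ar dg M).Hom (freeOperad k ar dg M).dual :=
  lift (fun s hn hd => (of k ar dg M s hn hd).prod (ψ s hn hd))

theorem derivHom_fst (ψ : ∀ {n : ℕ} {d : ℤ} (s : ι), ar s = n → dg s = d →
    (M s →ₗ[k] (freeOperad k ar dg M).Op n (d - 1))) {n : ℕ} {d : ℤ}
    (x : (freeOperad k ar dg M).Op n d) :
    (freeOperad k ar dg M).dualFst n d ((derivHom ψ).toFun n d x) = x := by
  have : ((freeOperad k ar dg M).dualFstHom).comp (derivHom ψ) = GradedNSOperad.Hom.id _ :=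
    hom_ext (fun s hn hd x => rfl)
  exact congrArg (fun F : (freeOperad k ar dg M).Hom (freeOperad k ar dg M) => F.toFun n d x) this

/-- The derivation of the free operad that extends a given map of degree `-1` on the generators. -/
def deriv (ψ : ∀ {n : ℕ} {d : ℤ} (s : ι), ar s = n → dg s = d →
    (M s →ₗ[k] (freeOperad k ar dg M).Op n (d - 1))) : (freeOperad k ar dg M).Deriv where
  toFun n d := (freeOperad k ar dg M).dualSnd n d ∘ₗ (derivHom ψ).toFun n d
  leibniz {m n r d e f} i hi hr hd h₁ h₂ x y := by
    simp only [LinearMap.comp_apply]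
    rw [(derivHom ψ).map_comp, GradedNSOperad.dualSnd_comp _ i hi hr hd h₁ h₂, derivHom_fst,
      derivHom_fst]

theorem deriv_of (ψ : ∀ {n : ℕ} {d : ℤ} (s : ι), ar s = n → dg s = d →
    (M s →ₗ[k] (freeOperad k ar dg M).Op n (d - 1))) {n : ℕ} {d : ℤ} (s : ι) (hn : ar s = n)
    (hd : dg s = d) (x : M s) :
    (deriv ψ).toFun n d (of k ar dg M s hn hd x) = ψ s hn hd x := rfl

end freeOperad

end Free

/-! ## The Koszul dual cooperad of the operad of linearly compatible di-algebras

`E` is the free module on two binary operations of degree `0`: `star` (the operation `∗`) and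
`bullet` (the operation `•`).  The cofree conilpotent cooperad `Tᶜ(sE)` has in arity `n` the basis
of planar binary trees with `n` leaves and with vertices labelled by the two operations.  A vertex
has degree `1`, so the tree lies in degree `n - 1`; it stands for the tensor product of its vertices
in the order root, left subtree, right subtree.  An element is written as its coefficient function
on trees. -/

/-- Planar binary trees with vertices labelled by the two binary operations. -/
abbrev OpTree : Type := BinaryTree (Fin 2)

namespace OpTree

open BinaryTree

/-- The operation `∗`. -/
abbrev star : Fin 2 := 0

/-- The operation `•`. -/
abbrev bullet : Fin 2 := 1

/-- `(x y₁ y₂) y₃`: the vertex `y` grafted on the first input of the root `x`. -/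
def leftComb (x y : Fin 2) : OpTree := node x (node y nil nil) nil

/-- The vertex `y` grafted on the second input of the root `x`. -/
def rightComb (x y : Fin 2) : OpTree := node x nil (node y nil nil)

/-- The number of vertices labelled by `x`. -/
def labelCount (x : Fin 2) : OpTree → ℕ
  | nil => 0
  | node y l r => (if y = x then 1 else 0) + labelCount x l + labelCount x r

/-- The tree `t ∘ₚ u`: graft `u` on the leaf number `p` of `t`, leaves being numbered from `0`. -/
def graft : OpTree → ℕ → OpTree → OpTree
  | nil, _, u => u
  | node x l r, p, u =>
    if p < l.numLeaves then node x (graft l p u) r else node x l (graft r (p - l.numLeaves) u)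

/-- The number of vertices of `t` that come after the leaf number `p` in the order root, left
subtree, right subtree. -/
def nodesAfter : OpTree → ℕ → ℕ
  | nil, _ => 0
  | node _ l r, p =>
    if p < l.numLeaves then nodesAfter l p + r.numNodes else nodesAfter r (p - l.numLeaves)

end OpTree

section Koszul

variable (k : Type u) [CommRing k]

/-- The arity `n` part of the cofree cooperad `Tᶜ(sE)`. -/
def cofree (n : ℕ) : Submodule k (OpTree → k) where
  carrier := {x | ∀ t : OpTree, t.numLeaves ≠ n → x t = 0}
  zero_mem' := fun _ _ => rfl
  add_mem' := fun hx hy t ht => by simp [hx t ht, hy t ht]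
  smul_mem' := fun c x hx t ht => by simp [hx t ht]

/-- The infinitesimal decomposition of `Tᶜ(sE)`, component `∘ₚ` with arities `m` and `n`: the
coefficient of `t₁ ∘ₚ t₂` in the decomposition of `x` is the coefficient in `x` of the tree obtained
by grafting, with the Koszul sign for moving the vertices of `t₂` (each of degree `1`) past the
vertices of `t₁` that come after the leaf number `p`. -/
def cofreeDecomp (m n p : ℕ) (x : OpTree → k) : OpTree × OpTree → k := fun t =>
  if t.1.numLeaves = m ∧ t.2.numLeaves = n then
    (-1) ^ (t.2.numNodes * OpTree.nodesAfter t.1 p) * x (OpTree.graft t.1 p t.2)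
  else 0

variable {k}

/-- The natural map from `A ⊗ B` to coefficient functions on pairs of trees. -/
noncomputable def pairCoeff (A B : Submodule k (OpTree → k)) :
    A ⊗[k] B →ₗ[k] (OpTree × OpTree → k) :=
  TensorProduct.lift (LinearMap.mk₂ k (fun x y t => x.1 t.1 * y.1 t.2)
    (by intro x x' y; ext t; simp [add_mul])
    (by intro c x y; ext t; simp [mul_assoc])
    (by intro x y y'; ext t; simp [mul_add])
    (by intro c x y; ext t; simp [mul_left_comm]))

/-- A family of submodules `S n ⊆ Tᶜ(sE)(n)` is a sub-cooperad when the decomposition maps it into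
the image of `S m ⊗ S n`. -/
structure IsSubcooperad (S : ℕ → Submodule k (OpTree → k)) : Prop where
  le_cofree : ∀ n, S n ≤ cofree k n
  decomp_mem : ∀ {r m n p : ℕ}, m + n = r + 1 → p < m → ∀ x ∈ S r,
    cofreeDecomp k m n p x ∈ LinearMap.range (pairCoeff (S m) (S n))

variable (k)

/-- The module `s²R ⊆ Tᶜ(sE)(3)` of relations of linearly compatible di-algebras: `∗` and `•` are
associative and `(x • y) ∗ z + (x ∗ y) • z = x • (y ∗ z) + x ∗ (y • z)`. -/
def compatibleRelations : Submodule k (OpTree → k) :=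
  open OpTree in
  Submodule.span k
    {Pi.single (leftComb star star) 1 - Pi.single (rightComb star star) 1,
     Pi.single (leftComb bullet bullet) 1 - Pi.single (rightComb bullet bullet) 1,
     Pi.single (leftComb star bullet) 1 + Pi.single (leftComb bullet star) 1
       - Pi.single (rightComb bullet star) 1 - Pi.single (rightComb star bullet) 1}

/-- The Koszul dual cooperad `(As²)^¡ = C(sE, s²R)`: the largest sub-cooperad of `Tᶜ(sE)` whose
part of weight two (that is, of arity three) lies in `s²R`.  Its part of arity `n` has degree
`n - 1`. -/
def koszulDual (n : ℕ) : Submodule k (OpTree → k) :=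
  ⨆ S : {S : ℕ → Submodule k (OpTree → k) // IsSubcooperad S ∧ S 3 ≤ compatibleRelations k}, S.1 n

theorem koszulDual_isSubcooperad : IsSubcooperad (koszulDual k) where
  le_cofree n := iSup_le fun S => S.2.1.le_cofree n
  decomp_mem {r m n p} hr hp x hx := by
    have hle : ∀ S : {S : ℕ → Submodule k (OpTree → k) //
        IsSubcooperad S ∧ S 3 ≤ compatibleRelations k}, ∀ n, S.1 n ≤ koszulDual k n :=
      fun S n => le_iSup (fun S : {S : ℕ → Submodule k (OpTree → k) //
        IsSubcooperad S ∧ S 3 ≤ compatibleRelations k} => S.1 n) S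
    have hmono : ∀ {A A' B B' : Submodule k (OpTree → k)}, A ≤ A' → B ≤ B' →
        LinearMap.range (pairCoeff A B) ≤ LinearMap.range (pairCoeff A' B') := by
      rintro A A' B B' hA hB _ ⟨z, rfl⟩
      refine ⟨TensorProduct.map (Submodule.inclusion hA) (Submodule.inclusion hB) z, ?_⟩
      induction z with
      | zero => simp
      | add z z' hz hz' => simp only [map_add, hz, hz']
      | tmul a b => rfl
    refine Submodule.iSup_induction _ (motive := fun x => cofreeDecomp k m n p x ∈
      LinearMap.range (pairCoeff (koszulDual k m) (koszulDual k n))) hx ?_ ?_ ?_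
    · intro S x hx
      exact hmono (hle S m) (hle S n) (S.2.1.decomp_mem hr hp x hx)
    · convert Submodule.zero_mem _
      ext t
      simp [cofreeDecomp]
    · intro x y hx hy
      convert Submodule.add_mem _ hx hy using 1
      ext t
      simp only [cofreeDecomp, Pi.add_apply]
      split_ifs <;> ring

theorem koszulDual_three_le : koszulDual k 3 ≤ compatibleRelations k :=
  iSup_le fun S => S.2.2

variable {k}

/-- The infinitesimal decomposition of a sub-cooperad, that is, the restriction of that of
`Tᶜ(sE)`. -/
@[ext]
structure SubcooperadDecomp (S : ℕ → Submodule k (OpTree → k)) where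
  toFun : ∀ {r m n : ℕ} (p : ℕ), m + n = r + 1 → p < m → (S r →ₗ[k] S m ⊗[k] S n)
  spec : ∀ {r m n : ℕ} (p : ℕ) (hr : m + n = r + 1) (hp : p < m) (x : S r),
    pairCoeff (S m) (S n) (toFun p hr hp x) = cofreeDecomp k m n p x

/-! ### The cobar construction -/

/-- The underlying operad `T(s⁻¹ C̄)` of the cobar construction: the arity `n` part of the
coaugmentation coideal `C̄` is `S n` for `n ≥ 2` and zero otherwise, and since `S n` has degree
`n - 1`, its desuspension has degree `n - 2`. -/
def cobarOperad (S : ℕ → Submodule k (OpTree → k)) : GradedNSOperad.{u, u} k :=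
  freeOperad k (ι := {n : ℕ // 2 ≤ n}) (fun s => s.1) (fun s => (s.1 : ℤ) - 2) (fun s => S s.1)

/-- The generator `s⁻¹ x`. -/
def cobarGen (S : ℕ → Submodule k (OpTree → k)) {n : ℕ} {d : ℤ} (hn : 2 ≤ n)
    (hd : (n : ℤ) - 2 = d) : S n →ₗ[k] (cobarOperad S).Op n d :=
  freeOperad.of k (ι := {n : ℕ // 2 ≤ n}) (fun s => s.1) (fun s => (s.1 : ℤ) - 2)
    (fun s => S s.1) ⟨n, hn⟩ rfl hd

/-- The map `s⁻¹ x ↦ ∑ -(-1)^|x'| s⁻¹ x' ∘ₚ s⁻¹ x''`, the sum being over the components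
`x' ∘ₚ x''` of the infinitesimal decomposition of `x` with `x'`, `x''` in `C̄`.  The sign comes from
`s⁻¹ ↦ - s⁻¹ ⊗ s⁻¹` and from moving the second `s⁻¹` past `x'`. -/
noncomputable def cobarOnGen (S : ℕ → Submodule k (OpTree → k)) (D : SubcooperadDecomp S)
    (r : ℕ) : S r →ₗ[k] (cobarOperad S).Op r ((r : ℤ) - 2 - 1) :=
  ∑ x : Finset.HasAntidiagonal.antidiagonal (r + 1), ∑ p : Fin x.1.1,
    if h : 2 ≤ x.1.1 ∧ 2 ≤ x.1.2 then
      (-(koszulSign k ((x.1.1 : ℤ) - 1))) •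
        (TensorProduct.lift
          (((cobarOperad S).comp (p : ℕ) p.2 (Finset.HasAntidiagonal.mem_antidiagonal.mp x.2)
            (show ((x.1.1 : ℤ) - 2) + ((x.1.2 : ℤ) - 2) = (r : ℤ) - 2 - 1 by
              have := Finset.HasAntidiagonal.mem_antidiagonal.mp x.2
              omega)).compl₁₂
            (cobarGen S h.1 rfl) (cobarGen S h.2 rfl)) ∘ₗ
          D.toFun (p : ℕ) (Finset.HasAntidiagonal.mem_antidiagonal.mp x.2) p.2)
    else 0

/-- The differential of the cobar construction: the derivation extending `cobarOnGen`. -/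
noncomputable def cobarDifferential (S : ℕ → Submodule k (OpTree → k))
    (D : SubcooperadDecomp S) : (cobarOperad S).Deriv :=
  freeOperad.deriv (fun {n d} s hn hd => by
    subst hn
    subst hd
    exact cobarOnGen S D s.1)

end Koszul

/-!
The cooperad `(As²)^¡` is computed explicitly, and everything else is read off from a basis of it.

*The cooperad.*  Give a planar binary tree `t` the sign `treeSign t`, minus `-1` to the power of the
number of pairs of a vertex and a vertex above its left input.  By `leftWeight_graft`, this sign
turns the infinitesimal decomposition of `Tᶜ(sE)` into the plain transpose of grafting, up to a sign
that depends only on the arities and on the leaf `p` (`treeSign_graft`).  In this normalization the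
three relations spanning `s²R` become the sums of all trees with three leaves and given labels.  An
element of a sub-cooperad with weight two part in `s²R` therefore has the same normalized
coefficient at two trees that differ by a rotation at one edge, combined with any permutation of the
two labels there (`CoeffEquiv.rotate`), and such moves turn every tree into a right comb with sorted
labels.  So the normalized coefficient depends only on the numbers of `∗` and `•`.  Conversely, the
elements with this property form a sub-cooperad (`labelInvariant`), which is thus the Koszul dual
cooperad (`koszulDual_eq_labelInvariant`); in arity `n` it is free on the signed sums
`classElt k n (i, j)` with `i + j + 1 = n`.

*Decomposition and freeness.*  Since these modules are free, with coordinates given up to sign by the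
coefficients at chosen trees, `S m ⊗ S n` embeds into the coefficient functions on pairs of trees.
Hence the decomposition of the cooperad exists and is unique, it sends the class sum of `v` to
`± ∑ μ_u ⊗ μ_w`, summed over `u + w = v` (`pairCoeff_classDecomp`), and the free operad on these
modules is free on the class sums (`existsUnique_hom_cobarOperad`).  Comparing signs gives the
formula for the differential (`cobarOnGen_classElt`).

*Square zero.*  By `Deriv.isDifferential_of_generators` it suffices to evaluate `∂²` on the
generators, where it is a sum of twofold composites.  The sequential ones cancel between
`(∂m_u) ∘ m_w` and `m_u ∘ (∂m_w)`, the parallel ones cancel in pairs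
(`signedComp_signedComp`), as for `A_∞`-algebras.
-/

/-! ### Signs and gradings on planar binary trees -/

namespace OpTree

open BinaryTree

/-- The numbers of vertices labelled by `∗` and by `•`. -/
def labels (t : OpTree) : ℕ × ℕ := (labelCount star t, labelCount bullet t)

/-- The sum over the vertices of `t` of the number of vertices above the left input. -/
def leftWeight : OpTree → ℕ
  | nil => 0
  | node _ l r => l.numNodes + leftWeight l + leftWeight r

theorem labels_node (x : Fin 2) (l r : OpTree) :
    labels (node x l r) = labels (node x nil nil) + labels l + labels r := by
  simp [labels, labelCount]

theorem numNodes_eq_labels (t : OpTree) : t.numNodes = t.labels.1 + t.labels.2 := by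
  induction t with
  | nil => rfl
  | node x l r hl hr =>
    rw [labels_node, numNodes, hl, hr]
    fin_cases x <;> simp [labels, labelCount] <;> omega

theorem numLeaves_eq_labels (t : OpTree) : t.numLeaves = t.labels.1 + t.labels.2 + 1 := by
  rw [numLeaves_eq_numNodes_succ, numNodes_eq_labels]

theorem labels_graft (t : OpTree) (p : ℕ) (u : OpTree) :
    labels (graft t p u) = labels t + labels u := by
  induction t generalizing p with
  | nil => simp [graft, labels, labelCount]
  | node x l r hl hr =>
    rw [graft]
    split_ifs
    · rw [labels_node, hl, labels_node x l r]; abel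
    · rw [labels_node, hr, labels_node x l r]; abel

theorem numLeaves_graft (t : OpTree) (p : ℕ) (u : OpTree) :
    (graft t p u).numLeaves = t.numLeaves + u.numNodes := by
  rw [numLeaves_eq_labels, labels_graft, numLeaves_eq_labels, numNodes_eq_labels u]
  simp only [Prod.fst_add, Prod.snd_add]
  ring

/-- Grafting `u` on the leaf `p` of `t` adds `u.numNodes` for each vertex having `p` above its left
input; there are as many of these as the leaves after `p` exceed the vertices after `p`. -/
theorem leftWeight_graft (t : OpTree) (p q : ℕ) (hp : p + 1 + q = t.numLeaves) (u : OpTree) :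
    leftWeight (graft t p u) + u.numNodes * nodesAfter t p =
      leftWeight t + leftWeight u + u.numNodes * q := by
  induction t generalizing p q with
  | nil =>
    obtain rfl : q = 0 := by simp at hp; omega
    simp [graft, leftWeight, nodesAfter]
  | node x l r hl hr =>
    simp only [numLeaves] at hp
    rw [graft, nodesAfter]
    split_ifs with h
    · have h1 := hl p (l.numLeaves - p - 1) (by omega)
      have h2 := numLeaves_graft l p u
      have h3 : q = (l.numLeaves - p - 1) + (r.numNodes + 1) := by
        have := numLeaves_eq_numNodes_succ r; omega
      rw [h3, leftWeight, leftWeight]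
      have h4 : (graft l p u).numNodes = l.numNodes + u.numNodes := by
        rw [numLeaves_eq_numNodes_succ, numLeaves_eq_numNodes_succ] at h2; omega
      rw [h4]
      linear_combination h1
    · have h1 := hr (p - l.numLeaves) q (by omega)
      rw [leftWeight, leftWeight]
      linear_combination h1

/-- The right comb with vertices labelled, from the root upwards, by the given list. -/
def comb : List (Fin 2) → OpTree
  | [] => nil
  | x :: L => node x nil (comb L)

/-- The labels of a tree in the order root, left subtree, right subtree. -/
def preorder : OpTree → List (Fin 2)
  | nil => []
  | node x l r => x :: (preorder l ++ preorder r)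

theorem count_preorder (t : OpTree) (x : Fin 2) : (preorder t).count x = labelCount x t := by
  induction t with
  | nil => rfl
  | node y l r hl hr =>
    simp only [preorder, List.count_cons, List.count_append, hl, hr, labelCount, beq_iff_eq]
    ring

theorem labels_comb (u : ℕ × ℕ) :
    labels (comb (List.replicate u.1 star ++ List.replicate u.2 bullet)) = u := by
  have key : ∀ (L : List (Fin 2)) (x : Fin 2), labelCount x (comb L) = L.count x := by
    intro L x
    induction L with
    | nil => rfl
    | cons y L ih =>
      simp only [comb, labelCount, ih, List.count_cons, beq_iff_eq]
      ring
  ext <;> simp [labels, key, List.count_replicate]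

theorem preorder_perm {t t' : OpTree} (h : labels t = labels t') :
    (preorder t).Perm (preorder t') := by
  rw [List.perm_iff_count]
  intro x
  rw [count_preorder, count_preorder]
  simp only [labels, Prod.mk.injEq] at h
  fin_cases x
  · exact h.1
  · exact h.2

end OpTree

/-! ### The Koszul dual cooperad -/

namespace OpTree

open BinaryTree

/-- The coefficient of the tree `t` in the element of the Koszul dual cooperad that belongs to the
labels of `t`.  The summand `1` in the exponent changes the sign of all these elements at once; a
bilinear formula such as the one for the differential is sensitive to it. -/
def treeSign (k : Type u) [CommRing k] (t : OpTree) : k := (-1) ^ (leftWeight t + 1)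

theorem treeSign_mul_self (k : Type u) [CommRing k] (t : OpTree) :
    treeSign k t * treeSign k t = 1 := by
  rw [treeSign, ← mul_pow]; simp

/-- The right comb with labels counted by `u`, those equal to `∗` nearest to the root. -/
def stdTree (u : ℕ × ℕ) : OpTree :=
  comb (List.replicate u.1 star ++ List.replicate u.2 bullet)

theorem labels_stdTree (u : ℕ × ℕ) : labels (stdTree u) = u := labels_comb u

theorem numLeaves_stdTree (u : ℕ × ℕ) : (stdTree u).numLeaves = u.1 + u.2 + 1 := by
  rw [numLeaves_eq_labels, labels_stdTree]

/-- Up to `treeSign`, the infinitesimal decomposition of the cofree cooperad is the plain transpose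
of grafting: the remaining sign depends only on the arities and on `p`. -/
theorem treeSign_graft (k : Type u) [CommRing k] (t s : OpTree) (p q : ℕ)
    (hp : p + 1 + q = t.numLeaves) :
    (-1) ^ (s.numNodes * nodesAfter t p) * treeSign k (graft t p s) =
      (-1) ^ (1 + q * s.numNodes) * (treeSign k t * treeSign k s) := by
  rw [treeSign, treeSign, treeSign, ← pow_add, ← pow_add, ← pow_add]
  have h := leftWeight_graft t p q hp s
  have e : s.numNodes * nodesAfter t p + (leftWeight (graft t p s) + 1) + 2 =
    1 + q * s.numNodes + (leftWeight t + 1 + (leftWeight s + 1)) := by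
    linear_combination h
  rw [← e, pow_add _ _ 2]
  simp

end OpTree

section

open BinaryTree OpTree Finset.HasAntidiagonal

variable (k : Type u) [CommRing k]

/-- The signed sum of all trees with the labels `u`. -/
def classSum (u : ℕ × ℕ) : OpTree → k := fun t => if labels t = u then treeSign k t else 0

/-- The elements of arity `n` of the cofree cooperad whose coefficients depend, up to `treeSign`,
only on the labels of the tree. -/
def labelInvariant (n : ℕ) : Submodule k (OpTree → k) where
  carrier := {x | x ∈ cofree k n ∧ ∀ t t' : OpTree, labels t = labels t' →
    treeSign k t * x t = treeSign k t' * x t'}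
  zero_mem' := ⟨Submodule.zero_mem _, fun _ _ _ => by simp⟩
  add_mem' := fun hx hy => ⟨Submodule.add_mem _ hx.1 hy.1, fun t t' h => by
    simp only [Pi.add_apply, mul_add, hx.2 t t' h, hy.2 t t' h]⟩
  smul_mem' := fun c x hx => ⟨Submodule.smul_mem _ _ hx.1, fun t t' h => by
    simp only [Pi.smul_apply, smul_eq_mul, mul_left_comm _ c, hx.2 t t' h]⟩

theorem classSum_mem_labelInvariant (u : ℕ × ℕ) {n : ℕ} (h : u.1 + u.2 + 1 = n) :
    classSum k u ∈ labelInvariant k n := by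
  refine ⟨fun t ht => ?_, fun t t' htt' => ?_⟩
  · refine if_neg fun e => ht ?_
    rw [numLeaves_eq_labels, e, h]
  · rw [classSum, classSum, htt']
    split_ifs
    · rw [treeSign_mul_self, treeSign_mul_self]
    · simp

/-- The element of arity `n` given by the signed sum of the trees with the labels `u`; it is zero
unless `n` is the arity of these trees. -/
def classElt (n : ℕ) (u : ℕ × ℕ) : labelInvariant k n :=
  if h : u.1 + u.2 + 1 = n then ⟨classSum k u, classSum_mem_labelInvariant k u h⟩ else 0

variable {k}

theorem classElt_coe (n : ℕ) (u : ℕ × ℕ) (t : OpTree) :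
    (classElt k n u : OpTree → k) t =
      if t.numLeaves = n ∧ labels t = u then treeSign k t else 0 := by
  rw [classElt]
  by_cases h : u.1 + u.2 + 1 = n
  · rw [dif_pos h]
    refine if_congr ⟨fun e => ⟨?_, e⟩, fun e => e.2⟩ rfl rfl
    rw [numLeaves_eq_labels, e, h]
  · rw [dif_neg h, if_neg]
    · rfl
    · rintro ⟨h1, rfl⟩
      exact h (by rw [← h1, numLeaves_eq_labels])

/-- The coordinate of `x` at the labels `u`. -/
def classCoord (n : ℕ) (u : ℕ × ℕ) : labelInvariant k n →ₗ[k] k where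
  toFun x := treeSign k (stdTree u) * (x : OpTree → k) (stdTree u)
  map_add' x y := by simp [mul_add]
  map_smul' c x := by simp [mul_left_comm]

theorem classCoord_classElt {n : ℕ} (u w : ℕ × ℕ) (h : w.1 + w.2 + 1 = n) :
    classCoord n u (classElt k n w) = if u = w then 1 else 0 := by
  show treeSign k _ * _ = _
  rw [classElt_coe, labels_stdTree, numLeaves_stdTree]
  by_cases e : u = w
  · subst e
    rw [if_pos ⟨h, rfl⟩, if_pos rfl, treeSign_mul_self]
  · rw [if_neg (fun h => e h.2), if_neg e, mul_zero]

/-- The class sums span; for `n = 0`, where `n - 1` is truncated, both sides are zero. -/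
theorem sum_classCoord_smul {n : ℕ} (x : labelInvariant k n) :
    ∑ u ∈ antidiagonal (n - 1), classCoord n u x • classElt k n u = x := by
  ext t
  rw [Submodule.coe_sum, Finset.sum_apply]
  simp only [Submodule.coe_smul, Pi.smul_apply, classElt_coe, smul_eq_mul]
  by_cases ht : t.numLeaves = n
  · rw [Finset.sum_eq_single (labels t)]
    · rw [if_pos ⟨ht, rfl⟩]
      show treeSign k _ * _ * _ = _
      rw [x.2.2 (stdTree (labels t)) t (labels_stdTree _), mul_right_comm, treeSign_mul_self,
        one_mul]
    · intro u _ hu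
      rw [if_neg (fun h => hu h.2.symm), mul_zero]
    · intro h
      refine absurd ?_ h
      rw [mem_antidiagonal, ← ht, numLeaves_eq_labels]
      rfl
  · rw [x.2.1 t ht]
    exact Finset.sum_eq_zero fun u _ => by rw [if_neg (fun h => ht h.1), mul_zero]

/-- A linear map out of `labelInvariant k n` is determined by its values on the class sums. -/
theorem labelInvariant_hom_ext {n : ℕ} {V : Type*} [AddCommGroup V] [Module k V]
    {f g : labelInvariant k n →ₗ[k] V}
    (h : ∀ u : ℕ × ℕ, u.1 + u.2 + 1 = n → f (classElt k n u) = g (classElt k n u)) : f = g := by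
  ext x
  rw [← sum_classCoord_smul x, map_sum, map_sum]
  refine Finset.sum_congr rfl fun u hu => ?_
  by_cases hn : u.1 + u.2 + 1 = n
  · rw [map_smul, map_smul, h u hn]
  · rw [classElt, dif_neg hn, smul_zero, map_zero, map_zero]

theorem pairCoeff_tmul (A B : Submodule k (OpTree → k)) (x : A) (y : B) (t : OpTree × OpTree) :
    pairCoeff A B (x ⊗ₜ y) t = (x : OpTree → k) t.1 * (y : OpTree → k) t.2 := rfl

theorem pairCoeff_labelInvariant_injective (m n : ℕ) :
    Function.Injective (pairCoeff (labelInvariant k m) (labelInvariant k n)) := by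
  -- A left inverse reads off the coefficients at pairs of standard trees.
  let F : (OpTree × OpTree → k) → labelInvariant k m ⊗[k] labelInvariant k n := fun f =>
    ∑ u ∈ antidiagonal (m - 1), ∑ w ∈ antidiagonal (n - 1),
      (treeSign k (stdTree u) * treeSign k (stdTree w) * f (stdTree u, stdTree w)) •
        (classElt k m u ⊗ₜ[k] classElt k n w)
  refine Function.LeftInverse.injective (g := F) fun z => ?_
  induction z with
  | zero => simp [F]
  | add z z' hz hz' =>
    rw [map_add]
    nth_rewrite 2 [← hz, ← hz']
    simp only [F, Pi.add_apply, mul_add, add_smul, Finset.sum_add_distrib]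
  | tmul x y =>
    nth_rewrite 2 [← sum_classCoord_smul x, ← sum_classCoord_smul y]
    rw [TensorProduct.sum_tmul]
    simp only [F, TensorProduct.tmul_sum, TensorProduct.smul_tmul_smul,
      pairCoeff_tmul]
    refine Finset.sum_congr rfl fun u _ => Finset.sum_congr rfl fun w _ => ?_
    congr 1
    exact mul_mul_mul_comm _ _ _ _

theorem pairCoeff_smul (A B : Submodule k (OpTree → k)) (c : k) (z : A ⊗[k] B)
    (t : OpTree × OpTree) : pairCoeff A B (c • z) t = c * pairCoeff A B z t := by
  rw [map_smul]; rfl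

/-- The decompositions of a pair of natural numbers as a sum of two such pairs. -/
instance Prod.instHasAntidiagonalNat : Finset.HasAntidiagonal (ℕ × ℕ) where
  antidiagonal v := (antidiagonal v.1 ×ˢ antidiagonal v.2).map
    (Equiv.prodProdProdComm ℕ ℕ ℕ ℕ).toEmbedding
  mem_antidiagonal {v x} := by
    simp only [Finset.mem_map_equiv, Finset.mem_product, mem_antidiagonal,
      Equiv.prodProdProdComm_symm, Equiv.prodProdProdComm_apply, Prod.ext_iff, Prod.fst_add,
      Prod.snd_add]

/-- The component `∘ₚ` with arities `m` and `n` of the infinitesimal decomposition of a class sum.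
The summands whose labels do not fit the arities vanish. -/
def classDecomp (k : Type u) [CommRing k] (m n p : ℕ) (v : ℕ × ℕ) :
    labelInvariant k m ⊗[k] labelInvariant k n :=
  ((-1) ^ (1 + (m - 1 - p) * (n - 1)) : k) •
    ∑ x ∈ antidiagonal v, classElt k m x.1 ⊗ₜ[k] classElt k n x.2

theorem pairCoeff_classDecomp {r m n p : ℕ} (hr : m + n = r + 1) (hp : p < m) (v : ℕ × ℕ) :
    pairCoeff _ _ (classDecomp k m n p v) = cofreeDecomp k m n p (classElt k r v) := by
  ext t
  rw [classDecomp, pairCoeff_smul, map_sum, Finset.sum_apply, cofreeDecomp]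
  simp only [pairCoeff_tmul, classElt_coe]
  by_cases ht : t.1.numLeaves = m ∧ t.2.numLeaves = n
  · obtain ⟨h1, h2⟩ := ht
    have hn : t.2.numNodes = n - 1 := by rw [← h2, numLeaves_eq_numNodes_succ]; rfl
    have hn1 : 0 < n := h2 ▸ numLeaves_pos _
    have hs := treeSign_graft k t.1 t.2 p (m - 1 - p) (by omega)
    have hg : (graft t.1 p t.2).numLeaves = r := by rw [numLeaves_graft]; omega
    simp only [h1, h2, hg, true_and, and_self, if_true, labels_graft]
    by_cases hv : labels t.1 + labels t.2 = v
    · rw [if_pos hv, hs, hn, Finset.sum_eq_single (labels t.1, labels t.2)]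
      · simp
      · rintro x - hx
        by_cases hx1 : labels t.1 = x.1
        · rw [if_neg (c := labels t.2 = x.2) (fun hx2 => hx (Prod.ext hx1.symm hx2.symm)), mul_zero]
        · rw [if_neg hx1, zero_mul]
      · exact fun h => absurd (mem_antidiagonal.mpr hv) h
    · rw [if_neg hv, mul_zero, Finset.sum_eq_zero, mul_zero]
      intro x hx
      by_cases hx1 : labels t.1 = x.1
      · rw [if_neg (c := labels t.2 = x.2), mul_zero]
        intro hx2
        exact hv (by rw [hx1, hx2, mem_antidiagonal.mp hx])
      · rw [if_neg hx1, zero_mul]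
  · rw [if_neg ht, Finset.sum_eq_zero, mul_zero]
    intro x _
    by_cases h1 : t.1.numLeaves = m
    · rw [if_neg (c := t.2.numLeaves = n ∧ _) (fun h => ht ⟨h1, h.1⟩), mul_zero]
    · rw [if_neg (fun h => h1 h.1), zero_mul]

theorem isSubcooperad_labelInvariant : IsSubcooperad (labelInvariant k) where
  le_cofree n x hx := hx.1
  decomp_mem {r m n p} hr hp x hx := by
    have key : ∀ y : labelInvariant k r, cofreeDecomp k m n p y ∈
        LinearMap.range (pairCoeff (labelInvariant k m) (labelInvariant k n)) := by
      intro y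
      refine ⟨∑ v ∈ antidiagonal (r - 1), classCoord r v y • classDecomp k m n p v, ?_⟩
      conv_rhs => rw [← sum_classCoord_smul y]
      rw [map_sum]
      ext t
      simp only [map_smul, pairCoeff_classDecomp hr hp, Finset.sum_apply, Pi.smul_apply,
        cofreeDecomp, Submodule.coe_sum, Submodule.coe_smul, smul_eq_mul]
      split_ifs
      · rw [Finset.mul_sum]
        exact Finset.sum_congr rfl fun _ _ => mul_left_comm _ _ _
      · simp
    exact key ⟨x, hx⟩

end

section

open BinaryTree OpTree Finset.HasAntidiagonal

variable {k : Type u} [CommRing k]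

theorem exists_eq_leftComb_or_rightComb {t : OpTree} (h : t.numLeaves = 3) :
    ∃ x y, t = leftComb x y ∨ t = rightComb x y := by
  have one : ∀ s : OpTree, s.numLeaves = 1 → s = nil := by
    rintro (_ | ⟨y, l, r⟩) hs
    · rfl
    · have := l.numLeaves_pos
      have := r.numLeaves_pos
      simp only [numLeaves] at hs
      omega
  have two : ∀ s : OpTree, s.numLeaves = 2 → ∃ y, s = node y nil nil := by
    rintro (_ | ⟨y, l, r⟩) hs
    · simp at hs
    · have := l.numLeaves_pos
      have := r.numLeaves_pos
      simp only [numLeaves] at hs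
      exact ⟨y, by rw [one l (by omega), one r (by omega)]⟩
  rcases t with _ | ⟨x, l, r⟩
  · simp at h
  · have := l.numLeaves_pos
    have := r.numLeaves_pos
    simp only [numLeaves] at h
    rcases (by omega : l.numLeaves = 1 ∨ l.numLeaves = 2) with hl | hl
    · obtain ⟨y, hy⟩ := two r (by omega)
      exact ⟨x, y, Or.inr (by rw [one l hl, hy, rightComb])⟩
    · obtain ⟨y, hy⟩ := two l hl
      exact ⟨x, y, Or.inl (by rw [one r (by omega), hy, leftComb])⟩

theorem eq_of_eq_on_combs {f g : OpTree → k} (hf : f ∈ cofree k 3) (hg : g ∈ cofree k 3)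
    (hl : ∀ x y, f (leftComb x y) = g (leftComb x y))
    (hr : ∀ x y, f (rightComb x y) = g (rightComb x y)) : f = g := by
  ext t
  by_cases ht : t.numLeaves = 3
  · obtain ⟨x, y, rfl | rfl⟩ := exists_eq_leftComb_or_rightComb ht
    exacts [hl x y, hr x y]
  · rw [hf t ht, hg t ht]

theorem single_mem_cofree {n : ℕ} {t : OpTree} (ht : t.numLeaves = n) (c : k) :
    Pi.single t c ∈ cofree k n :=
  fun s hs => Pi.single_eq_of_ne (M := fun _ => k) (fun e : s = t => hs (e ▸ ht)) c

theorem classSum_star_star : classSum k (2, 0) =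
    Pi.single (leftComb star star) 1 - Pi.single (rightComb star star) 1 := by
  refine eq_of_eq_on_combs (classSum_mem_labelInvariant k (2, 0) rfl).1
    (Submodule.sub_mem _ (single_mem_cofree (by rfl) _) (single_mem_cofree (by rfl) _)) ?_ ?_ <;>
  · intro x y
    fin_cases x <;> fin_cases y <;>
    simp [classSum, labels, labelCount, treeSign, leftWeight, leftComb, rightComb]

theorem classSum_bullet_bullet : classSum k (0, 2) =
    Pi.single (leftComb bullet bullet) 1 - Pi.single (rightComb bullet bullet) 1 := by
  refine eq_of_eq_on_combs (classSum_mem_labelInvariant k (0, 2) rfl).1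
    (Submodule.sub_mem _ (single_mem_cofree (by rfl) _) (single_mem_cofree (by rfl) _)) ?_ ?_ <;>
  · intro x y
    fin_cases x <;> fin_cases y <;>
    simp [classSum, labels, labelCount, treeSign, leftWeight, leftComb, rightComb]

theorem classSum_star_bullet : classSum k (1, 1) =
    Pi.single (leftComb star bullet) 1 + Pi.single (leftComb bullet star) 1
      - Pi.single (rightComb bullet star) 1 - Pi.single (rightComb star bullet) 1 := by
  refine eq_of_eq_on_combs (classSum_mem_labelInvariant k (1, 1) rfl).1
    (sub_mem (sub_mem (Submodule.add_mem _ (single_mem_cofree (by rfl) _)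
      (single_mem_cofree (by rfl) _))
      (single_mem_cofree (by rfl) _)) (single_mem_cofree (by rfl) _)) ?_ ?_ <;>
  · intro x y
    fin_cases x <;> fin_cases y <;>
    simp [classSum, labels, labelCount, treeSign, leftWeight, leftComb, rightComb]

variable (k) in
/-- The relations are spanned by the class sums of arity three. -/
theorem labelInvariant_three : labelInvariant k 3 = compatibleRelations k := by
  rw [compatibleRelations, ← classSum_star_star, ← classSum_bullet_bullet, ← classSum_star_bullet]
  apply le_antisymm
  · intro x hx
    rw [show x = _ from congrArg Subtype.val (sum_classCoord_smul ⟨x, hx⟩).symm, Submodule.coe_sum]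
    refine Submodule.sum_mem _ fun u hu => Submodule.smul_mem _ _ (Submodule.subset_span ?_)
    have hu' : u ∈ ({(2, 0), (0, 2), (1, 1)} : Finset (ℕ × ℕ)) := by
      revert hu; exact (by decide : ∀ u ∈ antidiagonal 2, u ∈ _) u
    simp only [Finset.mem_insert, Finset.mem_singleton] at hu'
    rcases hu' with rfl | rfl | rfl <;> simp [classElt]
  · rw [Submodule.span_le]
    rintro x (rfl | rfl | rfl) <;> exact classSum_mem_labelInvariant k _ rfl

variable {S : ℕ → Submodule k (OpTree → k)}

theorem mem_of_mem_range_pairCoeff_left {A B : Submodule k (OpTree → k)}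
    {f : OpTree × OpTree → k} (hf : f ∈ LinearMap.range (pairCoeff A B)) (t : OpTree) :
    (fun s => f (t, s)) ∈ B := by
  obtain ⟨z, rfl⟩ := hf
  induction z with
  | zero => rw [map_zero]; exact B.zero_mem
  | add z z' hz hz' => rw [map_add]; exact B.add_mem hz hz'
  | tmul x y => exact B.smul_mem ((x : OpTree → k) t) y.2

theorem mem_of_mem_range_pairCoeff_right {A B : Submodule k (OpTree → k)}
    {f : OpTree × OpTree → k} (hf : f ∈ LinearMap.range (pairCoeff A B)) (s : OpTree) :
    (fun t => f (t, s)) ∈ A := by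
  obtain ⟨z, rfl⟩ := hf
  induction z with
  | zero => rw [map_zero]; exact A.zero_mem
  | add z z' hz hz' => rw [map_add]; exact A.add_mem hz hz'
  | tmul x y =>
    convert A.smul_mem ((y : OpTree → k) s) x.2 using 1
    ext t
    exact mul_comm _ _

/-- The trees `t` and `t'` have the same number of leaves, and the same coefficient, up to
`treeSign`, in all elements of `S`. -/
def CoeffEquiv (S : ℕ → Submodule k (OpTree → k)) (t t' : OpTree) : Prop :=
  t.numLeaves = t'.numLeaves ∧
    ∀ n, ∀ x ∈ S n, treeSign k t * x t = treeSign k t' * x t'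

namespace CoeffEquiv

theorem refl (t : OpTree) : CoeffEquiv S t t := ⟨rfl, fun _ _ _ => rfl⟩

theorem symm {t t' : OpTree} (h : CoeffEquiv S t t') : CoeffEquiv S t' t :=
  ⟨h.1.symm, fun n x hx => (h.2 n x hx).symm⟩

theorem trans {t t' t'' : OpTree} (h : CoeffEquiv S t t') (h' : CoeffEquiv S t' t'') :
    CoeffEquiv S t t'' :=
  ⟨h.1.trans h'.1, fun n x hx => (h.2 n x hx).trans (h'.2 n x hx)⟩

/-- The decomposition in terms of coefficients normalized by `treeSign`: the sign on the right is
the same for all trees `t`, `s` with `m` and `n` leaves. -/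
theorem cofreeDecomp_eq (x : OpTree → k) {m n p : ℕ} {t s : OpTree} (ht : t.numLeaves = m)
    (hs : s.numLeaves = n) (hp : p < m) :
    treeSign k t * (treeSign k s * cofreeDecomp k m n p x (t, s)) =
      (-1) ^ (1 + (m - 1 - p) * (n - 1)) *
        (treeSign k (graft t p s) * x (graft t p s)) := by
  have hn : s.numNodes = n - 1 := by rw [← hs, numLeaves_eq_numNodes_succ]; rfl
  have h := treeSign_graft k t s p (m - 1 - p) (by omega)
  rw [cofreeDecomp, if_pos ⟨ht, hs⟩, ← hn]
  have e1 := treeSign_mul_self k t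
  have e2 := treeSign_mul_self k s
  have e3 := treeSign_mul_self k (graft t p s)
  linear_combination
    (treeSign k t * treeSign k s * treeSign k (graft t p s) * x (graft t p s)) * h
    - (treeSign k t * treeSign k s * (-1) ^ (s.numNodes * nodesAfter t p) * x (graft t p s)) * e3
    + ((-1) ^ (1 + (m - 1 - p) * s.numNodes) * treeSign k (graft t p s) * x (graft t p s)) *
      (treeSign k s * treeSign k s * e1 + e2)

theorem eq_of_neg_one_pow_mul_eq {e : ℕ} {a b : k} (h : (-1) ^ e * a = (-1) ^ e * b) : a = b := by
  have := congrArg ((-1) ^ e * ·) h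
  simpa [← mul_assoc, ← mul_pow] using this

theorem apply_eq_zero (hS : IsSubcooperad S) {n : ℕ} {x : OpTree → k} (hx : x ∈ S n) {t : OpTree}
    (ht : t.numLeaves ≠ n) : x t = 0 := hS.le_cofree n hx t ht

theorem graft_right (hS : IsSubcooperad S) {s s' : OpTree} (h : CoeffEquiv S s s') (t : OpTree)
    {p : ℕ} (hp : p < t.numLeaves) : CoeffEquiv S (graft t p s) (graft t p s') := by
  have hl : s.numNodes = s'.numNodes := by
    have := h.1
    rw [numLeaves_eq_numNodes_succ, numLeaves_eq_numNodes_succ] at this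
    omega
  have hg : (graft t p s).numLeaves = (graft t p s').numLeaves := by
    rw [numLeaves_graft, numLeaves_graft, hl]
  refine ⟨hg, fun r x hx => ?_⟩
  by_cases hr : (graft t p s).numLeaves = r
  · have hr' : t.numLeaves + s.numLeaves = r + 1 := by
      rw [← hr, numLeaves_graft, numLeaves_eq_numNodes_succ s, add_assoc]
    have hm := mem_of_mem_range_pairCoeff_left (hS.decomp_mem hr' hp x hx) t
    have e : treeSign k t * _ = treeSign k t * _ := congrArg _ (h.2 _ _ hm)
    rw [cofreeDecomp_eq x rfl rfl hp, cofreeDecomp_eq x rfl h.1.symm hp] at e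
    exact eq_of_neg_one_pow_mul_eq e
  · rw [apply_eq_zero hS hx hr, apply_eq_zero hS hx (hg ▸ hr), mul_zero, mul_zero]

theorem graft_left (hS : IsSubcooperad S) {t t' : OpTree} (h : CoeffEquiv S t t') (s : OpTree)
    {p : ℕ} (hp : p < t.numLeaves) : CoeffEquiv S (graft t p s) (graft t' p s) := by
  have hg : (graft t p s).numLeaves = (graft t' p s).numLeaves := by
    rw [numLeaves_graft, numLeaves_graft, h.1]
  refine ⟨hg, fun r x hx => ?_⟩
  by_cases hr : (graft t p s).numLeaves = r
  · have hr' : t.numLeaves + s.numLeaves = r + 1 := by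
      rw [← hr, numLeaves_graft, numLeaves_eq_numNodes_succ s, add_assoc]
    have hm := mem_of_mem_range_pairCoeff_right (hS.decomp_mem hr' hp x hx) s
    have e : treeSign k s * _ = treeSign k s * _ := congrArg _ (h.2 _ _ hm)
    rw [mul_left_comm (treeSign k s), mul_left_comm (treeSign k s), cofreeDecomp_eq x rfl rfl hp,
      cofreeDecomp_eq x h.1.symm rfl hp] at e
    exact eq_of_neg_one_pow_mul_eq e
  · rw [apply_eq_zero hS hx hr, apply_eq_zero hS hx (hg ▸ hr), mul_zero, mul_zero]

theorem node_left (hS : IsSubcooperad S) {l l' : OpTree} (h : CoeffEquiv S l l') (x : Fin 2)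
    (r : OpTree) : CoeffEquiv S (node x l r) (node x l' r) := by
  simpa [graft] using graft_right hS h (node x nil r) (p := 0) (by simp)

theorem node_right (hS : IsSubcooperad S) {r r' : OpTree} (h : CoeffEquiv S r r') (x : Fin 2)
    (l : OpTree) : CoeffEquiv S (node x l r) (node x l r') := by
  simpa [graft] using graft_right hS h (node x l nil) (p := l.numLeaves) (by simp)

theorem of_three (hS : IsSubcooperad S) (h3 : S 3 ≤ compatibleRelations k) {t t' : OpTree}
    (ht : t.numLeaves = 3) (h : labels t = labels t') : CoeffEquiv S t t' := by
  have ht' : t.numLeaves = t'.numLeaves := by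
    rw [numLeaves_eq_labels, h, ← numLeaves_eq_labels]
  refine ⟨ht', fun n x hx => ?_⟩
  by_cases hn : n = 3
  · subst hn
    exact ((labelInvariant_three k).symm ▸ h3 hx : x ∈ labelInvariant k 3).2 t t' h
  · rw [apply_eq_zero hS hx (by omega), apply_eq_zero hS hx (by omega), mul_zero, mul_zero]

/-- The relations of arity three, applied at an arbitrary place of a tree. -/
theorem rotate (hS : IsSubcooperad S) (h3 : S 3 ≤ compatibleRelations k) {x y x' y' : Fin 2}
    (h : labels (leftComb x y) = labels (rightComb x' y')) (a b c : OpTree) :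
    CoeffEquiv S (node x (node y a b) c) (node x' a (node y' b c)) := by
  have h0 := of_three hS h3 rfl h
  -- Grafting from right to left leaves the numbers of the remaining leaves unchanged.
  have h2 := graft_left hS h0 c (p := 2) (by simp [leftComb])
  have h1 := graft_left hS h2 b (p := 1) (by rw [numLeaves_graft]; simp [leftComb]; omega)
  have h0 := graft_left hS h1 a (p := 0) (numLeaves_pos _)
  simpa [graft, leftComb, rightComb] using h0

/-- Two rotations that permute the labels differently have the same source. -/
theorem swap (hS : IsSubcooperad S) (h3 : S 3 ≤ compatibleRelations k) (x y : Fin 2)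
    (a b c : OpTree) : CoeffEquiv S (node x a (node y b c)) (node y a (node x b c)) := by
  refine (rotate hS h3 (x := x) (y := y) ?_ a b c).symm.trans (rotate hS h3 ?_ a b c)
  · simp [labels, labelCount, leftComb, rightComb]
  · simp [labels, labelCount, leftComb, rightComb, add_comm]

/-- A tree whose subtrees at the root are right combs is straightened by rotations. -/
theorem comb_append (hS : IsSubcooperad S) (h3 : S 3 ≤ compatibleRelations k) (L L' : List (Fin 2))
    (x : Fin 2) : CoeffEquiv S (node x (comb L) (comb L')) (comb (x :: (L ++ L'))) := by
  induction L generalizing x with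
  | nil => exact refl _
  | cons y L ih =>
    refine (rotate hS h3 (x' := x) (y' := y) ?_ nil (comb L) (comb L')).trans ?_
    · simp [labels, labelCount, leftComb, rightComb]
    · exact node_right hS (ih y) x nil

theorem comb_preorder (hS : IsSubcooperad S) (h3 : S 3 ≤ compatibleRelations k) (t : OpTree) :
    CoeffEquiv S t (comb (preorder t)) := by
  induction t with
  | nil => exact refl _
  | node x l r hl hr =>
    exact ((node_left hS hl x r).trans (node_right hS hr x _)).trans (comb_append hS h3 _ _ x)

theorem comb_of_perm (hS : IsSubcooperad S) (h3 : S 3 ≤ compatibleRelations k)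
    {L L' : List (Fin 2)} (h : L.Perm L') : CoeffEquiv S (comb L) (comb L') := by
  induction h with
  | nil => exact refl _
  | cons x _ ih => exact node_right hS ih x nil
  | swap x y L => exact swap hS h3 y x nil nil (comb L)
  | trans _ _ ih ih' => exact ih.trans ih'

theorem of_labels_eq (hS : IsSubcooperad S) (h3 : S 3 ≤ compatibleRelations k) {t t' : OpTree}
    (h : labels t = labels t') : CoeffEquiv S t t' :=
  ((comb_preorder hS h3 t).trans (comb_of_perm hS h3 (preorder_perm h))).trans
    (comb_preorder hS h3 t').symm

end CoeffEquiv

variable (k) in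
theorem koszulDual_eq_labelInvariant : koszulDual k = labelInvariant k := by
  funext n
  apply le_antisymm
  · refine iSup_le fun ⟨S, hS, h3⟩ x hx => ⟨hS.le_cofree n hx, fun t t' h => ?_⟩
    exact (CoeffEquiv.of_labels_eq hS h3 h).2 n x hx
  · exact le_iSup (fun S : {S : ℕ → Submodule k (OpTree → k) //
        IsSubcooperad S ∧ S 3 ≤ compatibleRelations k} => S.1 n)
      ⟨labelInvariant k, isSubcooperad_labelInvariant, (labelInvariant_three k).le⟩

end

/-! ### A square-zero criterion for derivations -/

namespace GradedNSOperad

open Finset.HasAntidiagonal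

variable {k : Type u} [CommRing k]

theorem koszulSign_eq_neg_one_pow {d : ℤ} {n : ℕ} (h : Even (d - n)) :
    koszulSign k d = (-1) ^ n := by
  rw [koszulSign, (Int.negOnePow_eq_iff _ _).mpr h, Int.negOnePow_def]
  simp

theorem koszulSign_natCast_sub_two (n : ℕ) : koszulSign k ((n : ℤ) - 2) = (-1) ^ n :=
  koszulSign_eq_neg_one_pow ⟨-1, by ring⟩

theorem neg_one_pow_eq_neg {a b : ℕ} (h : Odd (a + b)) : (-1 : k) ^ a = -(-1) ^ b := by
  have e : (-1 : k) ^ a * (-1) ^ b = -1 := by rw [← pow_add, h.neg_one_pow]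
  have e' : (-1 : k) ^ b * (-1) ^ b = 1 := by rw [← mul_pow]; simp
  linear_combination (-1 : k) ^ b * e - (-1 : k) ^ a * e'

/-- The partial composition `x ∘ᵢ y` as an operation of prescribed arity and degree, with the junk
value `0` if `i` is not an input of `x` or if the arities or degrees do not fit. -/
def compOrZero (P : GradedNSOperad.{u, v} k) {m n : ℕ} {d e : ℤ} (r : ℕ) (f : ℤ) (i : ℕ) :
    P.Op m d →ₗ[k] P.Op n e →ₗ[k] P.Op r f :=
  if h : i < m ∧ m + n = r + 1 ∧ d + e = f then P.comp i h.1 h.2.1 h.2.2 else 0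

variable {P : GradedNSOperad.{u, v} k}

theorem compOrZero_eq_comp {m n r : ℕ} {d e f : ℤ} {i : ℕ} (hi : i < m) (hr : m + n = r + 1)
    (hd : d + e = f) (x : P.Op m d) (y : P.Op n e) :
    P.compOrZero r f i x y = P.comp i hi hr hd x y := by
  rw [compOrZero, dif_pos ⟨hi, hr, hd⟩]

theorem Deriv.toFun_compOrZero (D : P.Deriv) {m n r : ℕ} {d e f : ℤ} (i : ℕ)
    (x : P.Op m d) (y : P.Op n e) :
    D.toFun r f (P.compOrZero r f i x y) = P.compOrZero r (f - 1) i (D.toFun m d x) y +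
      koszulSign k d • P.compOrZero r (f - 1) i x (D.toFun n e y) := by
  by_cases h : i < m ∧ m + n = r + 1 ∧ d + e = f
  · rw [compOrZero_eq_comp h.1 h.2.1 h.2.2, compOrZero_eq_comp h.1 h.2.1 (by omega),
      compOrZero_eq_comp h.1 h.2.1 (by omega)]
    exact D.leibniz i h.1 h.2.1 h.2.2 (by omega) (by omega) x y
  · rw [compOrZero, compOrZero, compOrZero, dif_neg h, dif_neg (by omega), dif_neg (by omega)]
    simp

theorem compOrZero_seq {l m n a b r : ℕ} {d e f g h t : ℤ} {i j : ℕ} (hi : i < l) (hj : j < m)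
    (h₁ : l + m = a + 1) (g₁ : d + e = g) (h₂ : a + n = r + 1) (g₂ : g + f = t)
    (h₃ : m + n = b + 1) (g₃ : e + f = h) (x : P.Op l d) (y : P.Op m e) (z : P.Op n f) :
    P.compOrZero r t (i + j) (P.compOrZero a g i x y) z =
      P.compOrZero r t i x (P.compOrZero b h j y z) := by
  rw [compOrZero_eq_comp hi h₁ g₁, compOrZero_eq_comp (by omega) h₂ g₂,
    compOrZero_eq_comp hj h₃ g₃, compOrZero_eq_comp hi (by omega) (by omega)]
  exact P.comp_seq i j hi hj _ h₁ g₁ h₂ g₂ h₃ g₃ _ _ x y z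

theorem compOrZero_par {l m n a b r : ℕ} {d e f g h t : ℤ} {i j : ℕ} (hij : i < j) (hj : j < l)
    (h₁ : l + (m + 1) = a + 1) (g₁ : d + e = g) (h₂ : a + n = r + 1) (g₂ : g + f = t)
    (h₃ : l + n = b + 1) (g₃ : d + f = h) (x : P.Op l d) (y : P.Op (m + 1) e) (z : P.Op n f) :
    P.compOrZero r t (j + m) (P.compOrZero a g i x y) z =
      koszulSign k (e * f) • P.compOrZero r t i (P.compOrZero b h j x z) y := by
  rw [compOrZero_eq_comp (hij.trans hj) h₁ g₁, compOrZero_eq_comp (by omega) h₂ g₂,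
    compOrZero_eq_comp hj h₃ g₃, compOrZero_eq_comp (by omega) (by omega) (by omega)]
  exact P.comp_par i j (j + m) (hij.trans hj) hj hij rfl _ _ h₁ g₁ h₂ g₂ h₃ g₃ _ _ x y z

/-- Both sides sum over the triples with sum `v`. -/
theorem sum_antidiagonal_fst_eq_snd {A V : Type*} [AddCancelCommMonoid A]
    [Finset.HasAntidiagonal A] [AddCommMonoid V] (v : A) (F : A → A → A → V) :
    ∑ x ∈ antidiagonal v, ∑ y ∈ antidiagonal x.1, F y.1 y.2 x.2 =
      ∑ x ∈ antidiagonal v, ∑ y ∈ antidiagonal x.2, F x.1 y.1 y.2 := by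
  rw [Finset.sum_sigma', Finset.sum_sigma']
  refine Finset.sum_nbij' (fun z => ⟨(z.2.1, z.2.2 + z.1.2), (z.2.2, z.1.2)⟩)
    (fun z => ⟨(z.1.1 + z.2.1, z.2.2), (z.1.1, z.2.1)⟩) ?_ ?_ ?_ ?_ ?_
  · rintro ⟨⟨a, b⟩, ⟨c, d⟩⟩ h
    simp only [Finset.mem_sigma, mem_antidiagonal, and_true] at h ⊢
    rw [← add_assoc, h.2, h.1]
  · rintro ⟨⟨a, b⟩, ⟨c, d⟩⟩ h
    simp only [Finset.mem_sigma, mem_antidiagonal, and_true] at h ⊢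
    rw [add_assoc, h.2, h.1]
  · rintro ⟨⟨a, b⟩, ⟨c, d⟩⟩ h
    simp only [Finset.mem_sigma, mem_antidiagonal] at h ⊢
    rw [h.2]
  · rintro ⟨⟨a, b⟩, ⟨c, d⟩⟩ h
    simp only [Finset.mem_sigma, mem_antidiagonal] at h ⊢
    rw [h.2]
  · rintro ⟨⟨a, b⟩, ⟨c, d⟩⟩ h
    rfl

/-- Both sides sum over the pairs `i < j ≤ n`. -/
theorem sum_range_sum_range_sub {V : Type*} [AddCommMonoid V] (n : ℕ) (F : ℕ → ℕ → V) :
    ∑ i ∈ Finset.range (n + 1), ∑ l ∈ Finset.range (n - i), F i (i + 1 + l) =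
      ∑ j ∈ Finset.range (n + 1), ∑ i ∈ Finset.range j, F i j := by
  rw [Finset.sum_sigma', Finset.sum_sigma']
  refine Finset.sum_nbij' (fun z => ⟨z.1 + 1 + z.2, z.1⟩) (fun z => ⟨z.2, z.1 - z.2 - 1⟩)
    ?_ ?_ ?_ ?_ ?_
  · rintro ⟨i, l⟩ h
    simp only [Finset.mem_sigma, Finset.mem_range] at h ⊢
    omega
  · rintro ⟨i, l⟩ h
    simp only [Finset.mem_sigma, Finset.mem_range] at h ⊢
    omega
  · rintro ⟨i, l⟩ h
    simp only [Finset.mem_sigma, Finset.mem_range, Sigma.mk.injEq, heq_eq_eq, true_and] at h ⊢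
    omega
  · rintro ⟨i, l⟩ h
    simp only [Finset.mem_sigma, Finset.mem_range, Sigma.mk.injEq, heq_eq_eq, and_true] at h ⊢
    omega
  · rintro ⟨i, l⟩ h
    rfl

/-- The arity `|u| + 1` of an operation indexed by `u`. -/
abbrev indexArity (u : ℕ × ℕ) : ℕ := u.1 + u.2 + 1

/-- The degree `|u| - 1` of an operation indexed by `u`. -/
abbrev indexDegree (u : ℕ × ℕ) : ℤ := ((u.1 + u.2 + 1 : ℕ) : ℤ) - 2

/-- The sign of `m_u ∘ₚ m_w` in the differential of `m_{u + w}`. -/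
def compSign (k : Type u) [CommRing k] (u w : ℕ × ℕ) (p : ℕ) : k :=
  (-1) ^ (p + (w.1 + w.2 + 1) * (u.1 + u.2 - p))

/-- The composite `∑ₚ ± x ∘ₚ y` of operations of the arities and degrees indexed by `u` and `w`,
up to shifts of the degrees. -/
def signedComp (P : GradedNSOperad.{u, v} k) (u w : ℕ × ℕ) {d e : ℤ} (r : ℕ) (f : ℤ)
    (x : P.Op (indexArity u) d) (y : P.Op (indexArity w) e) : P.Op r f :=
  ∑ p ∈ Finset.range (u.1 + u.2 + 1), compSign k u w p • P.compOrZero r f p x y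

theorem signedComp_sum_left {ι : Type*} (s : Finset ι) (u w : ℕ × ℕ) {d e : ℤ} (r : ℕ) (f : ℤ)
    (x : ι → P.Op (indexArity u) d) (y : P.Op (indexArity w) e) :
    P.signedComp u w r f (∑ i ∈ s, x i) y = ∑ i ∈ s, P.signedComp u w r f (x i) y := by
  simp only [signedComp, map_sum, LinearMap.sum_apply, Finset.smul_sum]
  exact Finset.sum_comm

theorem signedComp_sum_right {ι : Type*} (s : Finset ι) (u w : ℕ × ℕ) {d e : ℤ} (r : ℕ) (f : ℤ)
    (x : P.Op (indexArity u) d) (y : ι → P.Op (indexArity w) e) :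
    P.signedComp u w r f x (∑ i ∈ s, y i) = ∑ i ∈ s, P.signedComp u w r f x (y i) := by
  simp only [signedComp, map_sum, Finset.smul_sum]
  exact Finset.sum_comm

section

variable (M : ∀ u : ℕ × ℕ, P.Op (indexArity u) (indexDegree u))

/-- The part of `∑ ± (m_a ∘ m_b) ∘ m_c` in which `m_c` is grafted to the left of `m_b`. -/
def parallelPart (a b c : ℕ × ℕ) (r : ℕ) (f : ℤ) : P.Op r f :=
  ∑ q ∈ Finset.range (a.1 + a.2 + 1), ∑ p ∈ Finset.range q,
    (compSign k (a + b) c p * compSign k a b q) • P.compOrZero r f p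
      (P.compOrZero (indexArity (a + b)) (indexDegree (a + b) - 1) q (M a) (M b)) (M c)

/-- The sequential composites in `∑ ± (m_a ∘ m_b) ∘ m_c` cancel those in `∑ ± m_a ∘ (m_b ∘ m_c)`,
and its parallel composites with `m_c` to the right of `m_b` are those of
`∑ ± (m_a ∘ m_c) ∘ m_b` with `m_b` to the left of `m_c`. -/
theorem signedComp_signedComp (a b c : ℕ × ℕ) {r : ℕ} {f : ℤ} (hr : indexArity (a + b + c) = r)
    (hf : indexDegree (a + b + c) - 1 - 1 = f) :
    P.signedComp (a + b) c r f (P.signedComp a b (indexArity (a + b)) (indexDegree (a + b) - 1)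
        (M a) (M b)) (M c) +
      koszulSign k (indexDegree a) • P.signedComp a (b + c) r f (M a)
        (P.signedComp b c (indexArity (b + c)) (indexDegree (b + c) - 1) (M b) (M c)) =
      parallelPart M a b c r f - parallelPart M a c b r f := by
  simp only [indexArity, indexDegree, Prod.fst_add, Prod.snd_add] at hr hf
  -- `m_c` is grafted before `m_b` (parallel), on an input of `m_b` (sequential), or after it.
  have hA : P.signedComp (a + b) c r f (P.signedComp a b (indexArity (a + b))
        (indexDegree (a + b) - 1) (M a) (M b)) (M c) =
      parallelPart M a b c r f +
      ∑ q ∈ Finset.range (a.1 + a.2 + 1), ∑ j ∈ Finset.range (b.1 + b.2 + 1),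
        (compSign k (a + b) c (q + j) * compSign k a b q) • P.compOrZero r f (q + j)
          (P.compOrZero (indexArity (a + b)) (indexDegree (a + b) - 1) q (M a) (M b)) (M c) +
      ∑ q ∈ Finset.range (a.1 + a.2 + 1), ∑ l ∈ Finset.range (a.1 + a.2 - q),
        (compSign k (a + b) c (q + 1 + l + (b.1 + b.2)) * compSign k a b q) •
          P.compOrZero r f (q + 1 + l + (b.1 + b.2))
          (P.compOrZero (indexArity (a + b)) (indexDegree (a + b) - 1) q (M a) (M b)) (M c) := by
    rw [parallelPart, ← Finset.sum_add_distrib, ← Finset.sum_add_distrib]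
    simp only [signedComp, map_sum, map_smul, LinearMap.sum_apply, LinearMap.smul_apply,
      Finset.smul_sum, smul_smul]
    rw [Finset.sum_comm]
    refine Finset.sum_congr rfl fun q hq => ?_
    have hq' := Finset.mem_range.mp hq
    have e : (a + b).1 + (a + b).2 + 1 = q + (b.1 + b.2 + 1) + (a.1 + a.2 - q) := by
      simp only [Prod.fst_add, Prod.snd_add]
      omega
    rw [e, Finset.sum_range_add, Finset.sum_range_add]
    congr 1
    refine Finset.sum_congr rfl fun l _ => ?_
    rw [show q + (b.1 + b.2 + 1) + l = q + 1 + l + (b.1 + b.2) by omega]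
  -- Each composite `m_a ∘ (m_b ∘ m_c)` is a sequential one, with the opposite sign.
  have hB : koszulSign k (indexDegree a) • P.signedComp a (b + c) r f (M a)
        (P.signedComp b c (indexArity (b + c)) (indexDegree (b + c) - 1) (M b) (M c)) =
      -∑ q ∈ Finset.range (a.1 + a.2 + 1), ∑ j ∈ Finset.range (b.1 + b.2 + 1),
        (compSign k (a + b) c (q + j) * compSign k a b q) • P.compOrZero r f (q + j)
          (P.compOrZero (indexArity (a + b)) (indexDegree (a + b) - 1) q (M a) (M b)) (M c) := by
    simp only [signedComp, map_sum, map_smul, Finset.smul_sum, smul_smul, ← Finset.sum_neg_distrib]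
    refine Finset.sum_congr rfl fun q hq => Finset.sum_congr rfl fun j hj => ?_
    rw [Finset.mem_range] at hq hj
    rw [compOrZero_seq (b := indexArity (b + c)) (h := indexDegree (b + c) - 1) hq hj,
      ← neg_smul]
    · congr 1
      obtain ⟨s, hs⟩ := Nat.exists_eq_add_of_le (Nat.le_of_lt_succ hq)
      obtain ⟨l, hl⟩ := Nat.exists_eq_add_of_le (Nat.le_of_lt_succ hj)
      rw [indexDegree, koszulSign_natCast_sub_two, compSign, compSign, compSign, compSign]
      simp only [Prod.fst_add, Prod.snd_add]
      rw [show a.1 + a.2 - q = s by omega, show b.1 + b.2 - j = l by omega,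
        show a.1 + b.1 + (a.2 + b.2) - (q + j) = s + l by omega, hs,
        show b.1 + c.1 + (b.2 + c.2) + 1 = b.1 + b.2 + (c.1 + c.2) + 1 by omega]
      generalize b.1 + b.2 = b', c.1 + c.2 = c'
      simp only [← pow_add]
      exact neg_one_pow_eq_neg ⟨2 * q + j + (c' + 1) * l + s * (b' + c' + 2), by ring⟩
    all_goals simp only [indexArity, indexDegree, Prod.fst_add, Prod.snd_add]; omega
  -- Grafting `m_c` to the right of `m_b` is grafting `m_b` to the left of `m_c`.
  have hC : ∑ q ∈ Finset.range (a.1 + a.2 + 1), ∑ l ∈ Finset.range (a.1 + a.2 - q),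
        (compSign k (a + b) c (q + 1 + l + (b.1 + b.2)) * compSign k a b q) •
          P.compOrZero r f (q + 1 + l + (b.1 + b.2))
          (P.compOrZero (indexArity (a + b)) (indexDegree (a + b) - 1) q (M a) (M b)) (M c) =
      -parallelPart M a c b r f := by
    rw [sum_range_sum_range_sub (a.1 + a.2) fun q j =>
        (compSign k (a + b) c (j + (b.1 + b.2)) * compSign k a b q) •
          P.compOrZero r f (j + (b.1 + b.2))
          (P.compOrZero (indexArity (a + b)) (indexDegree (a + b) - 1) q (M a) (M b)) (M c),
      parallelPart]
    simp only [← Finset.sum_neg_distrib]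
    refine Finset.sum_congr rfl fun j hj => Finset.sum_congr rfl fun i hi => ?_
    rw [Finset.mem_range] at hi hj
    rw [compOrZero_par (b := indexArity (a + c)) (h := indexDegree (a + c) - 1) hi hj, smul_smul,
      ← neg_smul]
    · congr 1
      have hk : koszulSign k (indexDegree b * indexDegree c) =
          (-1) ^ ((b.1 + b.2 + 1) * (c.1 + c.2 + 1)) :=
        koszulSign_eq_neg_one_pow
          ⟨2 - (b.1 + b.2 + 1 : ℕ) - (c.1 + c.2 + 1 : ℕ), by
            simp only [indexDegree]; push_cast; ring⟩
      obtain ⟨s, hs⟩ := Nat.exists_eq_add_of_lt hi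
      obtain ⟨l, hl⟩ := Nat.exists_eq_add_of_le (Nat.le_of_lt_succ hj)
      rw [hk, compSign, compSign, compSign, compSign]
      simp only [Prod.fst_add, Prod.snd_add]
      rw [show a.1 + b.1 + (a.2 + b.2) - (j + (b.1 + b.2)) = l by omega,
        show a.1 + a.2 - i = s + 1 + l by omega,
        show a.1 + c.1 + (a.2 + c.2) - i = s + 1 + l + (c.1 + c.2) by omega,
        show a.1 + a.2 - j = l by omega]
      generalize b.1 + b.2 = b', c.1 + c.2 = c'
      simp only [← pow_add]
      exact neg_one_pow_eq_neg
        ⟨i + j + (c' + 1) * l + (b' + 1) * (s + 1 + l) + (b' + 1) * c' + b', by ring⟩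
    all_goals simp only [indexArity, indexDegree, Prod.fst_add, Prod.snd_add]; omega
  rw [hA, hB, hC]
  abel

/-- A derivation is a differential on operations `m_u` whose differentials are the signed sums of
all composites `m_a ∘ₚ m_b` with `a + b = u`. -/
theorem Deriv.toFun_toFun_eq_zero (D : P.Deriv)
    (hD : ∀ u, D.toFun _ _ (M u) = ∑ x ∈ antidiagonal u,
      P.signedComp x.1 x.2 (indexArity u) (indexDegree u - 1) (M x.1) (M x.2)) (u : ℕ × ℕ) :
    D.toFun _ _ (D.toFun _ _ (M u)) = 0 := by
  set r := indexArity u with hr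
  set f := indexDegree u - 1 - 1 with hf
  have h1 : D.toFun _ _ (D.toFun _ _ (M u)) =
      ∑ x ∈ antidiagonal u, ∑ y ∈ antidiagonal x.1,
        P.signedComp (y.1 + y.2) x.2 r f (P.signedComp y.1 y.2 (indexArity (y.1 + y.2))
          (indexDegree (y.1 + y.2) - 1) (M y.1) (M y.2)) (M x.2) +
      ∑ x ∈ antidiagonal u, ∑ y ∈ antidiagonal x.2,
        koszulSign k (indexDegree x.1) • P.signedComp x.1 (y.1 + y.2) r f (M x.1)
          (P.signedComp y.1 y.2 (indexArity (y.1 + y.2)) (indexDegree (y.1 + y.2) - 1)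
            (M y.1) (M y.2)) := by
    rw [hD, map_sum, ← Finset.sum_add_distrib]
    refine Finset.sum_congr rfl fun x _ => ?_
    have e : D.toFun _ _ (P.signedComp x.1 x.2 (indexArity u) (indexDegree u - 1)
        (M x.1) (M x.2)) = P.signedComp x.1 x.2 r f (D.toFun _ _ (M x.1)) (M x.2) +
          koszulSign k (indexDegree x.1) •
            P.signedComp x.1 x.2 r f (M x.1) (D.toFun _ _ (M x.2)) := by
      simp only [signedComp, map_sum, map_smul, D.toFun_compOrZero, smul_add,
        Finset.sum_add_distrib, Finset.smul_sum]
      congr 1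
      exact Finset.sum_congr rfl fun p _ => smul_comm _ _ _
    rw [e, hD, hD]
    congr 1
    · rw [signedComp_sum_left]
      obtain ⟨w, c⟩ := x
      refine Finset.sum_congr rfl fun y hy => ?_
      obtain rfl := mem_antidiagonal.mp hy
      rfl
    · rw [signedComp_sum_right, Finset.smul_sum]
      obtain ⟨c, w⟩ := x
      refine Finset.sum_congr rfl fun y hy => ?_
      obtain rfl := mem_antidiagonal.mp hy
      rfl
  rw [h1, sum_antidiagonal_fst_eq_snd u fun a b c =>
    P.signedComp (a + b) c r f (P.signedComp a b (indexArity (a + b))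
          (indexDegree (a + b) - 1) (M a) (M b)) (M c), ← Finset.sum_add_distrib]
  refine Finset.sum_eq_zero fun x hx => ?_
  rw [← Finset.sum_add_distrib]
  have e : ∀ y ∈ antidiagonal x.2, x.1 + y.1 + y.2 = u := fun y hy => by
    rw [add_assoc, mem_antidiagonal.mp hy, mem_antidiagonal.mp hx]
  rw [Finset.sum_congr rfl fun y hy => signedComp_signedComp M x.1 y.1 y.2
    (r := r) (f := f) (by rw [e y hy]) (by rw [e y hy]), Finset.sum_sub_distrib, sub_eq_zero]
  exact Finset.sum_equiv (Equiv.prodComm _ _) (fun y => by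
    simp only [mem_antidiagonal, Equiv.prodComm_apply, Prod.fst_swap, Prod.snd_swap, add_comm])
    (fun _ _ => rfl)

end

end GradedNSOperad

/-! ### Differentials on free operads -/

namespace GradedNSOperad

variable {k : Type u} [CommRing k]

theorem koszulSign_sub_one (d : ℤ) : koszulSign k (d - 1) = -koszulSign k d := by
  simp [koszulSign, Int.negOnePow_sub]

theorem Deriv.toFun_one {P : GradedNSOperad.{u, v} k} (D : P.Deriv) : D.toFun 1 0 P.one = 0 := by
  have h := D.leibniz (m := 1) (n := 1) (r := 1) (d := 0) (e := 0) (f := 0) 0 zero_lt_one rfl rfl rfl rfl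
    P.one P.one
  rw [P.comp_one 0 zero_lt_one rfl rfl, P.comp_one 0 zero_lt_one rfl (by rfl), P.one_comp,
    koszulSign_zero, one_smul] at h
  exact left_eq_add.mp h

/-- A derivation of a free operad is a differential when its square vanishes on the generators. -/
theorem Deriv.isDifferential_of_generators {ι : Type} {ar : ι → ℕ} {dg : ι → ℤ} {M : ι → Type u}
    [∀ s, AddCommGroup (M s)] [∀ s, Module k (M s)] (D : (freeOperad k ar dg M).Deriv)
    (h : ∀ (s : ι) (x : M s), D.toFun _ _ (D.toFun _ _ (freeOperad.of k ar dg M s rfl rfl x)) = 0) :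
    D.IsDifferential := by
  have key : ∀ {n : ℕ} {d : ℤ} (x : PreFreeOp k ar dg M n d),
      D.toFun n (d - 1) (D.toFun n d (freeOperad.mk x)) = 0 := by
    intro n d x
    induction x with
    | of s hn hd x =>
      subst hn hd
      exact h s x
    | one =>
      have e : D.toFun 1 0 (freeOperad.mk (k := k) (ar := ar) (dg := dg) (M := M) .one) = 0 :=
        D.toFun_one
      rw [e, map_zero]
    | @comp m n r d e f i hi hr hd x y ihx ihy =>
      have e : freeOperad.mk (.comp i hi hr hd x y) =
        (freeOperad k ar dg M).comp i hi hr hd (freeOperad.mk x) (freeOperad.mk y) := rfl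
      rw [e, D.leibniz i hi hr hd (by omega) (by omega), map_add, map_smul,
        D.leibniz i hi hr _ (by omega) (by omega), D.leibniz i hi hr _ (by omega) (by omega),
        ihx, ihy, koszulSign_sub_one]
      simp
    | @zero n d =>
      have e : freeOperad.mk (.zero : PreFreeOp k ar dg M n d) = 0 := rfl
      rw [e, map_zero, map_zero]
    | add x y ihx ihy =>
      have e : freeOperad.mk (.add x y) = freeOperad.mk x + freeOperad.mk y := rfl
      rw [e, map_add, map_add, ihx, ihy, add_zero]
    | smul c x ih =>
      have e : freeOperad.mk (.smul c x) = c • freeOperad.mk x := rfl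
      rw [e, map_smul, map_smul, ih, smul_zero]
  rintro n d ⟨x⟩
  exact key x

end GradedNSOperad

/-! ### The cobar construction of the Koszul dual cooperad -/

section

open GradedNSOperad Finset.HasAntidiagonal

variable {k : Type u} [CommRing k] {S : ℕ → Submodule k (OpTree → k)}

theorem SubcooperadDecomp.eq_of_injective
    (hinj : ∀ m n, Function.Injective (pairCoeff (S m) (S n))) (D D' : SubcooperadDecomp S) :
    D' = D := by
  ext r m n p hr hp x
  exact hinj m n ((D'.spec p hr hp x).trans (D.spec p hr hp x).symm)

/-- The infinitesimal decomposition of the cofree cooperad as a linear map. -/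
def cofreeDecompLinear (k : Type u) [CommRing k] (m n p : ℕ) :
    (OpTree → k) →ₗ[k] (OpTree × OpTree → k) where
  toFun := cofreeDecomp k m n p
  map_add' x y := by
    ext t
    simp only [cofreeDecomp, Pi.add_apply]
    split_ifs <;> ring
  map_smul' c x := by
    ext t
    simp only [cofreeDecomp, Pi.smul_apply, smul_eq_mul, RingHom.id_apply]
    split_ifs <;> ring

/-- The restriction of the infinitesimal decomposition of the cofree cooperad to a sub-cooperad
`S` for which `S m ⊗ S n` embeds into the coefficient functions. -/
noncomputable def SubcooperadDecomp.ofInjective (hS : IsSubcooperad S)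
    (hinj : ∀ m n, Function.Injective (pairCoeff (S m) (S n))) : SubcooperadDecomp S where
  toFun {r m n} p hr hp := (LinearEquiv.ofInjective _ (hinj m n)).symm.toLinearMap ∘ₗ
    ((cofreeDecompLinear k m n p).comp (S r).subtype).codRestrict _
      (fun x => hS.decomp_mem hr hp x x.2)
  spec {_ m n} _ hr hp x := congrArg Subtype.val
    ((LinearEquiv.ofInjective _ (hinj m n)).apply_symm_apply ⟨_, hS.decomp_mem hr hp x x.2⟩)

variable (k) in
/-- The generator of arity `n` given by the signed sum of the trees with the labels `u`; it is zero
unless `n` is the arity of these trees and `2 ≤ n`. -/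
def classGen (n : ℕ) (u : ℕ × ℕ) : (cobarOperad (labelInvariant k)).Op n ((n : ℤ) - 2) :=
  if h : 2 ≤ n then cobarGen (labelInvariant k) h rfl (classElt k n u) else 0

theorem classGen_eq_zero {n : ℕ} {u : ℕ × ℕ} (h : indexArity u ≠ n) : classGen k n u = 0 := by
  rw [classGen]
  split_ifs
  · rw [classElt, dif_neg h, map_zero]
  · rfl

theorem SubcooperadDecomp.toFun_classElt (D : SubcooperadDecomp (labelInvariant k)) {r m n p : ℕ}
    (hr : m + n = r + 1) (hp : p < m) (v : ℕ × ℕ) :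
    D.toFun p hr hp (classElt k r v) = classDecomp k m n p v :=
  pairCoeff_labelInvariant_injective m n
    ((D.spec p hr hp _).trans (pairCoeff_classDecomp hr hp v).symm)

/-- The sign of the cobar construction times the sign of the decomposition is the sign in the
formula for the differential. -/
theorem compSign_eq (u w : ℕ × ℕ) {p : ℕ} (hp : p < indexArity u) :
    -(koszulSign k ((indexArity u : ℤ) - 1)) *
      (-1) ^ (1 + (indexArity u - 1 - p) * (indexArity w - 1)) = compSign k u w p := by
  obtain ⟨s, hs⟩ := Nat.exists_eq_add_of_le (Nat.le_of_lt_succ hp)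
  rw [koszulSign_eq_neg_one_pow (n := u.1 + u.2) ⟨0, by simp [indexArity]⟩, compSign, indexArity,
    indexArity, Nat.add_sub_cancel, Nat.add_sub_cancel, show u.1 + u.2 - p = s by omega, hs]
  ring

theorem cobarOnGen_classElt (D : SubcooperadDecomp (labelInvariant k)) (v : ℕ × ℕ) :
    cobarOnGen (labelInvariant k) D (indexArity v) (classElt k (indexArity v) v) =
      ∑ y ∈ antidiagonal v, (cobarOperad (labelInvariant k)).signedComp y.1 y.2 (indexArity v)
        (indexDegree v - 1) (classGen k _ y.1) (classGen k _ y.2) := by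
  set r := indexArity v with hr
  let P := cobarOperad (labelInvariant k)
  let T : ℕ × ℕ → ℕ → (ℕ × ℕ) × (ℕ × ℕ) → P.Op r (indexDegree v - 1) := fun x p y =>
    (-(koszulSign k ((x.1 : ℤ) - 1)) * (-1) ^ (1 + (x.1 - 1 - p) * (x.2 - 1))) •
      P.compOrZero r (indexDegree v - 1) p (classGen k x.1 y.1) (classGen k x.2 y.2)
  have h1 : cobarOnGen (labelInvariant k) D r (classElt k r v) =
      ∑ x ∈ antidiagonal (r + 1), ∑ p ∈ Finset.range x.1, ∑ y ∈ antidiagonal v, T x p y := by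
    rw [cobarOnGen, LinearMap.sum_apply, ← Finset.sum_coe_sort (antidiagonal (r + 1))
      fun x => ∑ p ∈ Finset.range x.1, ∑ y ∈ antidiagonal v, T x p y]
    refine Finset.sum_congr rfl fun x _ => ?_
    rw [LinearMap.sum_apply, ← Fin.sum_univ_eq_sum_range
      (fun p => ∑ y ∈ antidiagonal v, T x.1 p y) x.1.1]
    refine Finset.sum_congr rfl fun p _ => ?_
    have hx := mem_antidiagonal.mp x.2
    split_ifs with h
    · rw [LinearMap.smul_apply, LinearMap.comp_apply, D.toFun_classElt, classDecomp, map_smul,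
        map_sum, smul_smul, Finset.smul_sum]
      refine Finset.sum_congr rfl fun y _ => ?_
      simp only [T, classGen, dif_pos h.1, dif_pos h.2]
      rw [compOrZero_eq_comp p.2 hx (by simp only [hr, indexArity, indexDegree] at hx ⊢; omega)]
      rfl
    · rw [LinearMap.zero_apply, Finset.sum_eq_zero]
      intro y _
      simp only [T, classGen]
      by_cases h2 : 2 ≤ x.1.1
      · rw [dif_neg (c := 2 ≤ x.1.2) (fun h3 => h ⟨h2, h3⟩), map_zero, smul_zero]
      · rw [dif_neg h2, map_zero, LinearMap.zero_apply, smul_zero]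
  -- A pair of labels `y` contributes only for the arities `x` of its two class sums.
  have h2 : ∀ x ∈ antidiagonal (r + 1), ∑ p ∈ Finset.range x.1, ∑ y ∈ antidiagonal v, T x p y =
      ∑ y ∈ antidiagonal v, ∑ p ∈ Finset.range x.1, T x p y := fun x _ => Finset.sum_comm
  rw [h1, Finset.sum_congr rfl h2, Finset.sum_comm]
  refine Finset.sum_congr rfl fun y hy => ?_
  have hy' := mem_antidiagonal.mp hy
  rw [Finset.sum_eq_single (indexArity y.1, indexArity y.2)]
  · rw [signedComp]
    refine Finset.sum_congr rfl fun p hp => ?_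
    simp only [T]
    rw [compSign_eq y.1 y.2 (Finset.mem_range.mp hp)]
  · rintro x - hx
    refine Finset.sum_eq_zero fun p _ => ?_
    simp only [T]
    by_cases hx1 : indexArity y.1 = x.1
    · rw [classGen_eq_zero (n := x.2) (fun hx2 => hx (Prod.ext hx1.symm hx2.symm)), map_zero,
        smul_zero]
    · rw [classGen_eq_zero (n := x.1) hx1, map_zero, LinearMap.zero_apply, smul_zero]
  · intro h
    refine absurd (mem_antidiagonal.mpr ?_) h
    simp only [hr, ← hy', indexArity, Prod.fst_add, Prod.snd_add]
    omega

theorem cobarDifferential_classGen (D : SubcooperadDecomp (labelInvariant k)) (v : ℕ × ℕ) :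
    (cobarDifferential (labelInvariant k) D).toFun _ _ (classGen k (indexArity v) v) =
      ∑ y ∈ antidiagonal v, (cobarOperad (labelInvariant k)).signedComp y.1 y.2 (indexArity v)
        (indexDegree v - 1) (classGen k _ y.1) (classGen k _ y.2) := by
  by_cases h : 2 ≤ indexArity v
  · rw [← cobarOnGen_classElt D, classGen, dif_pos h]
    rfl
  · rw [classGen, dif_neg h, map_zero, eq_comm, Finset.sum_eq_zero]
    intro y hy
    have : ¬ 2 ≤ indexArity y.1 := by
      rw [← mem_antidiagonal.mp hy] at h
      simp only [indexArity, Prod.fst_add, Prod.snd_add] at h ⊢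
      omega
    rw [signedComp, Finset.sum_eq_zero]
    intro p _
    rw [classGen, dif_neg this, map_zero, LinearMap.zero_apply, smul_zero]

theorem cobarDifferential_isDifferential (D : SubcooperadDecomp (labelInvariant k)) :
    (cobarDifferential (labelInvariant k) D).IsDifferential := by
  refine Deriv.isDifferential_of_generators _ fun ⟨n, hn⟩ x => ?_
  let δ := cobarDifferential (labelInvariant k) D
  have key : δ.toFun _ _ ∘ₗ δ.toFun _ _ ∘ₗ cobarGen (labelInvariant k) hn rfl = 0 := by
    refine labelInvariant_hom_ext fun u hu => ?_
    subst hu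
    have h : δ.toFun _ _ (δ.toFun _ _ (classGen k (indexArity u) u)) = 0 :=
      δ.toFun_toFun_eq_zero (fun u => classGen k (indexArity u) u)
        (cobarDifferential_classGen D) u
    rw [show classGen k (indexArity u) u = cobarGen (labelInvariant k) hn rfl (classElt k _ u) from
      dif_pos hn] at h
    exact h
  exact LinearMap.congr_fun key x

/-- The operad underlying the cobar construction is free on the class sums. -/
theorem existsUnique_hom_cobarOperad (Q : GradedNSOperad.{u, v} k)
    (q : ∀ i j : ℕ, 1 ≤ i + j → Q.Op (i + j + 1) (((i + j + 1 : ℕ) : ℤ) - 2)) :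
    ∃! F : (cobarOperad (labelInvariant k)).Hom Q, ∀ (i j : ℕ) (h : 1 ≤ i + j),
      F.toFun _ _ (classGen k (i + j + 1) (i, j)) = q i j h := by
  -- The prescribed values, transported to all arities and degrees.
  let q' : ∀ (n : ℕ) (d : ℤ) (u : ℕ × ℕ), Q.Op n d := fun n d u =>
    if h : indexArity u = n ∧ indexDegree u = d ∧ 1 ≤ u.1 + u.2 then
      h.1 ▸ h.2.1 ▸ q u.1 u.2 h.2.2 else 0
  let F : (cobarOperad (labelInvariant k)).Hom Q :=
    freeOperad.lift fun {n d} s _ _ =>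
      ∑ u ∈ antidiagonal (s.1 - 1), (classCoord s.1 u).smulRight (q' n d u)
  have hF : ∀ (i j : ℕ) (h : 1 ≤ i + j), F.toFun _ _ (classGen k (i + j + 1) (i, j)) = q i j h := by
    intro i j h
    have hn : 2 ≤ i + j + 1 := Nat.succ_le_succ h
    have e : F.toFun _ _ (cobarGen (labelInvariant k) hn rfl (classElt k (i + j + 1) (i, j))) =
        (∑ u ∈ antidiagonal (i + j + 1 - 1), (classCoord (i + j + 1) u).smulRight
          (q' (i + j + 1) (((i + j + 1 : ℕ) : ℤ) - 2) u)) (classElt k (i + j + 1) (i, j)) := rfl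
    rw [classGen, dif_pos hn, e, LinearMap.sum_apply, Finset.sum_eq_single (i, j)]
    · rw [LinearMap.smulRight_apply, classCoord_classElt (n := i + j + 1) _ (i, j) rfl, if_pos rfl, one_smul]
      exact dif_pos ⟨rfl, rfl, h⟩
    · intro u _ hu
      rw [LinearMap.smulRight_apply, classCoord_classElt (n := i + j + 1) _ (i, j) rfl, if_neg hu, zero_smul]
    · exact fun h => absurd (mem_antidiagonal.mpr (by simp)) h
  refine ⟨F, hF, fun G hG => freeOperad.hom_ext ?_⟩
  rintro n d ⟨n', hn'⟩ hn hd x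
  obtain rfl : n' = n := hn
  subst hd
  have key : G.toFun _ _ ∘ₗ cobarGen (labelInvariant k) hn' rfl =
      F.toFun _ _ ∘ₗ cobarGen (labelInvariant k) hn' rfl := by
    refine labelInvariant_hom_ext fun u hu => ?_
    subst hu
    have h := (hG u.1 u.2 (Nat.le_of_succ_le_succ hn')).trans
      (hF u.1 u.2 (Nat.le_of_succ_le_succ hn')).symm
    rwa [classGen, dif_pos hn'] at h
  exact LinearMap.congr_fun key x

end

/-! ### Generators and differential of `As²_∞` -/

open GradedNSOperad Finset.HasAntidiagonal in
theorem signedComp_eq_sum_antidiagonal {k : Type u} [CommRing k] {P : GradedNSOperad.{u, v} k}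
    (u w : ℕ × ℕ) {d e : ℤ} (r : ℕ) (f : ℤ)
    (x : P.Op (indexArity u) d) (y : P.Op (indexArity w) e) :
    P.signedComp u w r f x y = ∑ z ∈ antidiagonal (u.1 + u.2),
      ((-1 : k) ^ (z.1 + (w.1 + w.2 + 1) * z.2)) • P.compOrZero r f z.1 x y :=
  (Finset.Nat.sum_antidiagonal_eq_sum_range_succ
    (fun p q => ((-1 : k) ^ (p + (w.1 + w.2 + 1) * q)) • P.compOrZero r f p x y) _).symm

open Finset.HasAntidiagonal in
theorem sum_antidiagonal_prod {V : Type*} [AddCommMonoid V] (i j : ℕ)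
    (F : (ℕ × ℕ) × (ℕ × ℕ) → V) :
    ∑ w ∈ antidiagonal (i, j), F w = ∑ x ∈ antidiagonal i, ∑ y ∈ antidiagonal j,
      F ((x.1, y.1), (x.2, y.2)) := by
  rw [← Finset.sum_product']
  exact Finset.sum_map _ _ _

open GradedNSOperad in
theorem mainTheorem3 (k : Type u) [CommRing k] :
    ∃ D : SubcooperadDecomp (koszulDual k),
      (∀ D' : SubcooperadDecomp (koszulDual k), D' = D) ∧
      (cobarDifferential (koszulDual k) D).IsDifferential ∧
      ∃ μ : ∀ i j : ℕ, koszulDual k (i + j + 1),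
        (∀ (i j : ℕ) (t : OpTree),
          (OpTree.labelCount OpTree.star t = i ∧ OpTree.labelCount OpTree.bullet t = j →
            (μ i j : OpTree → k) t = 1 ∨ (μ i j : OpTree → k) t = -1) ∧
          (¬ (OpTree.labelCount OpTree.star t = i ∧ OpTree.labelCount OpTree.bullet t = j) →
            (μ i j : OpTree → k) t = 0)) ∧
        ∃ m : ∀ i j : ℕ, 1 ≤ i + j →
            (cobarOperad (koszulDual k)).Op (i + j + 1) (((i + j + 1 : ℕ) : ℤ) - 2),
          (∀ (i j : ℕ) (h : 1 ≤ i + j), m i j h = cobarGen (koszulDual k) (by omega) rfl (μ i j)) ∧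
          (∀ (Q : GradedNSOperad.{u, v} k)
            (q : ∀ i j : ℕ, 1 ≤ i + j → Q.Op (i + j + 1) (((i + j + 1 : ℕ) : ℤ) - 2)),
            ∃! F : (cobarOperad (koszulDual k)).Hom Q,
              ∀ (i j : ℕ) (h : 1 ≤ i + j), F.toFun _ _ (m i j h) = q i j h) ∧
          ∀ (i j : ℕ) (h : 1 ≤ i + j),
            (cobarDifferential (koszulDual k) D).toFun _ _ (m i j h) =
              ∑ x : Finset.HasAntidiagonal.antidiagonal i, ∑ y : Finset.HasAntidiagonal.antidiagonal j,
                ∑ z : Finset.HasAntidiagonal.antidiagonal (x.1.1 + y.1.1),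
                  if h' : 1 ≤ x.1.1 + y.1.1 ∧ 1 ≤ x.1.2 + y.1.2 then
                    ((-1 : k) ^ (z.1.1 + (x.1.2 + y.1.2 + 1) * z.1.2)) •
                      (cobarOperad (koszulDual k)).comp z.1.1
                        (by have := Finset.HasAntidiagonal.mem_antidiagonal.mp z.2; omega)
                        (by have := Finset.HasAntidiagonal.mem_antidiagonal.mp x.2
                            have := Finset.HasAntidiagonal.mem_antidiagonal.mp y.2; omega)
                        (by have := Finset.HasAntidiagonal.mem_antidiagonal.mp x.2
                            have := Finset.HasAntidiagonal.mem_antidiagonal.mp y.2; omega)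
                        (m x.1.1 y.1.1 h'.1) (m x.1.2 y.1.2 h'.2)
                  else 0 := by
  rw [koszulDual_eq_labelInvariant]
  let D : SubcooperadDecomp (labelInvariant k) :=
    .ofInjective isSubcooperad_labelInvariant pairCoeff_labelInvariant_injective
  have hgen : ∀ (a b : ℕ) (h : 1 ≤ a + b), classGen k (indexArity (a, b)) (a, b) =
      cobarGen (labelInvariant k) (by omega) rfl (classElt k (a + b + 1) (a, b)) :=
    fun a b h => dif_pos (by simpa [indexArity] using h)
  refine ⟨D, D.eq_of_injective pairCoeff_labelInvariant_injective,
    cobarDifferential_isDifferential D, fun i j => classElt k (i + j + 1) (i, j), ?_,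
    fun i j h => cobarGen (labelInvariant k) (by omega) rfl (classElt k (i + j + 1) (i, j)),
    fun _ _ _ => rfl, fun Q q => ?_, ?_⟩
  · intro i j t
    have e : (classElt k (i + j + 1) (i, j) : OpTree → k) t = classSum k (i, j) t :=
      congrFun (congrArg Subtype.val (dif_pos rfl)) t
    rw [e]
    exact ⟨fun h => by rw [classSum, if_pos (Prod.ext h.1 h.2)]; exact neg_one_pow_eq_or k _,
      fun h => if_neg fun h' => h (Prod.ext_iff.mp h')⟩
  · obtain ⟨F, hF, hu⟩ := existsUnique_hom_cobarOperad Q q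
    exact ⟨F, fun i j h => (congrArg _ (hgen i j h)).symm.trans (hF i j h),
      fun G hG => hu G fun i j h => (congrArg _ (hgen i j h)).trans (hG i j h)⟩
  · intro i j h
    have hD := cobarDifferential_classGen D (i, j)
    rw [hgen i j h, sum_antidiagonal_prod] at hD
    refine hD.trans ?_
    rw [← Finset.sum_coe_sort]
    refine Finset.sum_congr rfl fun x _ => ?_
    rw [← Finset.sum_coe_sort]
    refine Finset.sum_congr rfl fun y _ => ?_
    rw [signedComp_eq_sum_antidiagonal, ← Finset.sum_coe_sort]
    refine Finset.sum_congr rfl fun z _ => ?_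
    split_ifs with h'
    · rw [hgen _ _ h'.1, hgen _ _ h'.2, compOrZero_eq_comp]
    · by_cases h1 : 1 ≤ x.1.1 + y.1.1
      · have : classGen k (indexArity (x.1.2, y.1.2)) (x.1.2, y.1.2) = 0 :=
          dif_neg fun h2 => h' ⟨h1, by simpa [indexArity] using h2⟩
        rw [this, map_zero, smul_zero]
      · have : classGen k (indexArity (x.1.1, y.1.1)) (x.1.1, y.1.1) = 0 :=
          dif_neg fun h2 => h1 (by simpa [indexArity] using h2)
        rw [this, map_zero, LinearMap.zero_apply, smul_zero]
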